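/- Let $\mathfrak g$ be the Kac–Moody algebra (not necessarily symmetrizable) over a field of characteristic $0$ given by a generalized Cartan matrix and a realization with Cartan subalgebra $\mathfrak h$, simple roots $\alpha_i$ and simple coroots $\alpha_i^\vee$ ($i\in I$), with Chevalley generators $e_i,f_i$, simple reflections $s_i$ and Weyl group $W$. Let $J=(i_1,i_2,\dots)$ be a finite or infinite sequence in $I$ such that $w_j:=s_{i_j}\cdots s_{i_1}$ is a reduced decomposition for every $j$. Fix $t\in I$, a fundamental weight $\varpi_t$, and an integrable $\mathfrak g$-module $V=V(-\varpi_t)$ generated by a lowest weight vector of weight $-\varpi_t$. A trail $K$ is a sequence of non-zero weight vectors $v_1,v_2,\dots$ in $V$, of weights $\gamma^K_1,\gamma^K_2,\dots$, such that $v_{j+1}=e_{i_j}^{n_j}v_j$ with $n_j\in\mathbb N$ for all $j\in J$; $\gamma^K_1=-s_t\varpi_t$; $\gamma^K_{j+1}=-w_j\varpi_t$ for all $j\in J$ from some point $j_0\in J$ on (we then say that $K$ trivializes at every $j\ge j_0$); and $\gamma^K_j-\gamma_j^{K_t^1}\in\sum_i\mathbb N\alpha_i$ for all $j\in J$. Here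 $K_t^1$ is the driving trail: with $u$ the first position with $i_u=t$, $\gamma_j^{K^1_t}=-s_t\varpi_t$ for $j\le u+1$ and $\gamma_j^{K^1_t}=-s_{i_{j-1}}\cdots s_{i_{u+1}}s_t\varpi_t$ for $j>u+1$. Let $K$ be a trail trivializing at $j_*\in J$, put $s=i_{j_*}$, $w=w_{j_*}$, and assume $s\ne t$ or $K\ne K_t^1$. Let $j_*$ be the $n$-th position at which $s$ occurs in $J$. Let $v_{\mu_1}$, of weight $\mu_1$, be the vector of $K$ just before the first occurrence of $s$, and for $2\le i\le n$ let $e_{\mu_i}$, of weight $\mu_i$, be the product of the powers $e_{i_q}^{n_q}$ of $K$ over the positions $q$ strictly between the $(i-1)$-st and the $i$-th occurrence of $s$. Put $a_i=-\mu_i(\alpha_s^\vee)$, and for $\mathbf k=(k_n,\dots,k_1)\in\mathbb N^n$ put $$\overline v_{\mathbf k}=e_s^{k_n}e_{\mu_n}e_s^{k_{n-1}}e_{\mu_{n-1}}\cdots e_{\mu_2}e_s^{k_1}v_{\mu_1}.$$ Let $T_s^+(\mathbf a)$ (resp. $T_s^-(\mathbf a)$) be the set of $\mathbf k$ for which $\overline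 v_{\mathbf k}$ is a non-zero multiple of the extremal vector of weight $-w\varpi_t$ (resp. $-s_sw\varpi_t$), and let $T_s(\mathbf a)$ be the set of $\mathbf k$ such that $e_s^p\,\overline v_{\mathbf k}$ is a non-zero multiple of the extremal vector of weight $-w\varpi_t$ for some $p\in\mathbb N$. Let $\mathbf l=(\ell_n,\dots,\ell_1)$ be the minimum of $T_s^+(\mathbf a)$ for the lexicographic order that compares the entries of index $1,2,\dots,n$ in this order (the $\ell$-minimal trail). For a tuple $x$ write $x^{(j)}=x_1+\dots+x_j$, and set $c_j=a^{(j)}-\ell^{(j)}-\ell^{(j-1)}$ and $c'_j=c'_j(\mathbf k)=k^{(j)}-\ell^{(j)}$ for $1\le j\le n$. Let $N=\{1,\dots,n-1\}$ and choose an enumeration $u_1,\dots,u_{n-1}$ of $N$ with $c_{u_1}\le\dots\le c_{u_{n-1}}$. Let $K^-_{\mathbb Z}(\mathbf c)$ be the set of $(d_j)_{j\in N}\in\mathbb Z^{n-1}$ with $d_{n-1}=0$ (if $n\ge2$), with $0\le d_j\le c_j$ for all $j\in N$, and such that for every $j\in N$: if $y$ is the successor of $u_j$ in $\{u_1,\dots,u_j\}$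 for the natural order (when it exists), then $d_y-d_{u_j}\ge-(c_{u_j}-c_y)$; if $x$ is its predecessor (when it exists), then $d_{u_j}-d_x\ge0$. Proposition. Suppose that $\{(c'_j(\mathbf k))_{j\in N}:\mathbf k\in T_s^-(\mathbf a)\}=K^-_{\mathbb Z}(\mathbf c)$. Then every $\mathbf k\in T_s(\mathbf a)$ satisfies the upper bounds: for all $j=1,\dots,n$, $$c'_j(\mathbf k)\le c_j,\qquad\text{equivalently}\qquad a^{(j)}-k^{(j)}-\ell^{(j-1)}\ge0 .$$ -/

import Mathlib

namespace KMTrail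

/-! ### Kac-Moody algebras -/

/-- The data from which a Kac-Moody algebra is constructed: a generalized Cartan matrix `A`
(not assumed symmetrizable) and a realization of it, that is, linearly independent simple roots in
the dual of a vector space `H` and linearly independent simple coroots in `H`, paired by `A`.
No minimality of the dimension of `H` is imposed. -/
structure Datum (𝕜 I H : Type*) [Field 𝕜] [AddCommGroup H] [Module 𝕜 H] where
  A : Matrix I I ℤ
  diag : ∀ i, A i i = 2
  offDiag_nonpos : ∀ i j, i ≠ j → A i j ≤ 0
  zero_symm : ∀ i j, A i j = 0 → A j i = 0
  root : I → Module.Dual 𝕜 H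
  coroot : I → H
  root_indep : LinearIndependent 𝕜 root
  coroot_indep : LinearIndependent 𝕜 coroot
  root_coroot : ∀ i j, root j (coroot i) = (A i j : 𝕜)

/-- Generators of the auxiliary Lie algebra. -/
inductive Gen (I H : Type*)
  | e (i : I)
  | f (i : I)
  | h (x : H)

section Construction

variable {𝕜 I H : Type*} [Field 𝕜] [DecidableEq I] [AddCommGroup H] [Module 𝕜 H]

/-- The generators in the free Lie algebra. -/
noncomputable def freeGen (𝕜 : Type*) {I H : Type*} [Field 𝕜] (g : Gen I H) :
    FreeLieAlgebra 𝕜 (Gen I H) :=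
  FreeLieAlgebra.of 𝕜 g

/-- The defining relations of the auxiliary Lie algebra; each listed element is set to zero. -/
inductive IsRelator (D : Datum 𝕜 I H) : FreeLieAlgebra 𝕜 (Gen I H) → Prop
  | h_add (x y : H) : IsRelator D (freeGen 𝕜 (.h (x + y) : Gen I H)
      - (freeGen 𝕜 (.h x : Gen I H) + freeGen 𝕜 (.h y : Gen I H)))
  | h_smul (r : 𝕜) (x : H) : IsRelator D
      (freeGen 𝕜 (.h (r • x) : Gen I H) - r • freeGen 𝕜 (.h x : Gen I H))
  | h_h (x y : H) : IsRelator D ⁅freeGen 𝕜 (.h x : Gen I H), freeGen 𝕜 (.h y : Gen I H)⁆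
  | e_f (i j : I) : IsRelator D (⁅freeGen 𝕜 (.e i : Gen I H), freeGen 𝕜 (.f j : Gen I H)⁆
      - if i = j then freeGen 𝕜 (.h (D.coroot i) : Gen I H) else 0)
  | h_e (x : H) (i : I) : IsRelator D
      (⁅freeGen 𝕜 (.h x : Gen I H), freeGen 𝕜 (.e i : Gen I H)⁆
        - (D.root i x) • freeGen 𝕜 (.e i : Gen I H))
  | h_f (x : H) (i : I) : IsRelator D
      (⁅freeGen 𝕜 (.h x : Gen I H), freeGen 𝕜 (.f i : Gen I H)⁆
        + (D.root i x) • freeGen 𝕜 (.f i : Gen I H))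

/-- The auxiliary Lie algebra: generators `e i`, `f i`, `h x` and the relations above. -/
abbrev Aux (D : Datum 𝕜 I H) : Type _ :=
  FreeLieAlgebra 𝕜 (Gen I H) ⧸
    (LieSubmodule.lieSpan 𝕜 (FreeLieAlgebra 𝕜 (Gen I H)) {x | IsRelator D x})

/-- The image of a generator in the auxiliary Lie algebra. -/
noncomputable def auxGen (D : Datum 𝕜 I H) (g : Gen I H) : Aux D :=
  LieSubmodule.Quotient.mk (freeGen 𝕜 g)

/-- The largest ideal of the auxiliary Lie algebra that meets the image of `H` trivially: the sum
of all ideals that meet it trivially. -/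
noncomputable def radical (D : Datum 𝕜 I H) : LieIdeal 𝕜 (Aux D) :=
  sSup {N : LieIdeal 𝕜 (Aux D) | ∀ x : H, auxGen D (Gen.h x) ∈ N → auxGen D (Gen.h x) = 0}

/-- The Kac-Moody algebra of the datum. -/
abbrev KacMoody (D : Datum 𝕜 I H) : Type _ := Aux D ⧸ radical D

/-- The image of a generator in the Kac-Moody algebra. -/
noncomputable def gen (D : Datum 𝕜 I H) (g : Gen I H) : KacMoody D :=
  LieSubmodule.Quotient.mk (auxGen D g)

end Construction

/-! ### Weyl group -/

section Weyl

variable {𝕜 I H : Type*} [Field 𝕜] [AddCommGroup H] [Module 𝕜 H]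

/-- The simple reflection of the dual of `H`. -/
def simpleReflection (D : Datum 𝕜 I H) (i : I) : Module.End 𝕜 (Module.Dual 𝕜 H) where
  toFun μ := μ - μ (D.coroot i) • D.root i
  map_add' μ ν := by
    simp only [LinearMap.add_apply, add_smul]
    abel
  map_smul' r μ := by
    simp only [LinearMap.smul_apply, smul_eq_mul, mul_smul, smul_sub, RingHom.id_apply]

/-- A finite or infinite sequence `letter 0, letter 1, …` (of which only the first `len` entries
matter); its `j`-th Weyl group element is the product
`s_{letter (j-1)} ⋯ s_{letter 1} s_{letter 0}`. -/
def weylElt (D : Datum 𝕜 I H) (letter : ℕ → I) : ℕ → Module.End 𝕜 (Module.Dual 𝕜 H)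
  | 0 => 1
  | j + 1 => simpleReflection D (letter j) * weylElt D letter j

/-- A finite or infinite sequence of indices all of whose initial segments are reduced: no product
of fewer simple reflections is the same Weyl group element. -/
structure ReducedSeq (D : Datum 𝕜 I H) where
  len : ℕ∞
  letter : ℕ → I
  reduced : ∀ j : ℕ, (j : ℕ∞) ≤ len → ∀ word : List I,
    (word.map (simpleReflection D)).prod = weylElt D letter j → j ≤ word.length

/-- The element `w_j` given by the first `j` letters. -/
def ReducedSeq.w {D : Datum 𝕜 I H} (J : ReducedSeq D) (j : ℕ) :
    Module.End 𝕜 (Module.Dual 𝕜 H) :=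
  weylElt D J.letter j

/-- `ϖ` is a fundamental weight for the index `t`. -/
def IsFundamentalWeight [DecidableEq I] (D : Datum 𝕜 I H) (t : I) (ϖ : Module.Dual 𝕜 H) : Prop :=
  ∀ i, ϖ (D.coroot i) = if i = t then 1 else 0

end Weyl

/-! ### Modules -/

section Modules

variable {𝕜 I H : Type*} [Field 𝕜] [DecidableEq I] [AddCommGroup H] [Module 𝕜 H]
variable (D : Datum 𝕜 I H) (V : Type*) [AddCommGroup V] [Module 𝕜 V]
  [LieRingModule (KacMoody D) V] [LieModule 𝕜 (KacMoody D) V]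

/-- The action on `V` of a generator. -/
noncomputable def act (g : Gen I H) : Module.End 𝕜 V := LieModule.toEnd 𝕜 (KacMoody D) V (gen D g)

variable {V}

/-- `v` is a non-zero vector of weight `μ`. -/
def IsWeightVector (μ : Module.Dual 𝕜 H) (v : V) : Prop :=
  v ≠ 0 ∧ ∀ x : H, act D V (Gen.h x) v = μ x • v

variable (V)

/-- `V` is an integrable lowest weight module of lowest weight `μ`. -/
structure IsIntegrableLowestWeight (μ : Module.Dual 𝕜 H) : Prop where
  lowest : ∃ v : V, IsWeightVector D μ v ∧ (∀ i, act D V (Gen.f i) v = 0) ∧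
    LieSubmodule.lieSpan 𝕜 (KacMoody D) {v} = ⊤
  e_nilpotent : ∀ (i : I) (v : V), ∃ m : ℕ, (act D V (Gen.e i) ^ m) v = 0
  f_nilpotent : ∀ (i : I) (v : V), ∃ m : ℕ, (act D V (Gen.f i) ^ m) v = 0

end Modules

/-! ### Trails -/

section Trails

variable {𝕜 I H : Type*} [Field 𝕜] [DecidableEq I] [AddCommGroup H] [Module 𝕜 H]
variable {D : Datum 𝕜 I H} (J : ReducedSeq D) (t : I) (ϖ : Module.Dual 𝕜 H)

/-- The weights of the initial driving trail: constantly `-s_t ϖ` up to and including the step at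
the first occurrence of `t`; after that, each letter acts by its reflection. -/
def drivingWeight : ℕ → Module.Dual 𝕜 H
  | 0 => -simpleReflection D t ϖ
  | p + 1 => if ∀ q < p, J.letter q ≠ t then -simpleReflection D t ϖ
      else simpleReflection D (J.letter p) (drivingWeight p)

variable (V : Type*) [AddCommGroup V] [Module 𝕜 V]
  [LieRingModule (KacMoody D) V] [LieModule 𝕜 (KacMoody D) V]

/-- Trails: `vec p` is the vector reached after the first `p` letters. -/
structure Trail where
  vec : ℕ → V
  weight : ℕ → Module.Dual 𝕜 H
  exponent : ℕ → ℕ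
  isWeight : ∀ p : ℕ, (p : ℕ∞) ≤ J.len → IsWeightVector D (weight p) (vec p)
  step : ∀ p : ℕ, (p : ℕ∞) < J.len →
    (act D V (Gen.e (J.letter p)) ^ exponent p) (vec p) = vec (p + 1)
  start : weight 0 = -simpleReflection D t ϖ
  boundary : ∃ j : ℕ, 1 ≤ j ∧ (j : ℕ∞) ≤ J.len ∧
    ∀ p : ℕ, j ≤ p → (p : ℕ∞) ≤ J.len → weight p = -(J.w p ϖ)
  positive : ∀ p : ℕ, (p : ℕ∞) < J.len →
    weight p - drivingWeight J t ϖ p ∈ AddSubmonoid.closure (Set.range D.root)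

variable {J t ϖ V}

/-- The trail trivializes at `w_j`. -/
def Trail.TrivializesAt (K : Trail J t ϖ V) (j : ℕ) : Prop :=
  ∀ p : ℕ, j ≤ p → (p : ℕ∞) ≤ J.len → K.weight p = -(J.w p ϖ)

/-- The trail is the initial driving trail (a trail is determined by its sequence of weights). -/
def Trail.IsDriving (K : Trail J t ϖ V) : Prop :=
  ∀ p : ℕ, (p : ℕ∞) ≤ J.len → K.weight p = drivingWeight J t ϖ p

/-! ### The trails of type `s` modelled on a given trail

Fix a trail `K`, an index `s` and a position `j`, the last of the first `j` letters being the
`n`-th occurrence of `s`. All exponents at the letters different from `s` are kept; the exponents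
at the `n` occurrences of `s` are replaced by a tuple `k : Fin n → ℕ` (the exponent `k_i`
of the `i`-th occurrence is the entry of index `i - 1`). -/

/-- The number `n` of occurrences of `s` among the first `j` letters. -/
abbrev occ (J : ReducedSeq D) (s : I) (j : ℕ) : ℕ := Nat.count (fun p => J.letter p = s) j

/-- The modified exponents. -/
def Trail.newExponent (K : Trail J t ϖ V) (s : I) (j : ℕ) (k : Fin (occ J s j) → ℕ) (p : ℕ) : ℕ :=
  if J.letter p = s then
    (if h : occ J s p < occ J s j then k ⟨occ J s p, h⟩ else 0)
  else K.exponent p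

variable (J) in
/-- The result of applying successively the powers `e_{letter p} ^ m p` for `p = 0, 1, …`. -/
noncomputable def ladder (m : ℕ → ℕ) (v : V) : ℕ → V
  | 0 => v
  | p + 1 => (act D V (Gen.e (J.letter p)) ^ m p) (ladder m v p)

/-- The vector `e_s^{k_n} e_{μ_n} e_s^{k_{n-1}} ⋯ e_{μ_2} e_s^{k_1} v_{μ_1}`. It may be zero. -/
noncomputable def Trail.vecOf (K : Trail J t ϖ V) (s : I) (j : ℕ) (k : Fin (occ J s j) → ℕ) : V :=
  ladder J (K.newExponent s j k) (K.vec 0) j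

/-- The tuples `k` whose vector is a non-zero multiple of the extremal vector of weight
`-w_j ϖ`, the highest weight vector (the weight space is a line). -/
def Trail.Tplus (K : Trail J t ϖ V) (s : I) (j : ℕ) : Set (Fin (occ J s j) → ℕ) :=
  {k | IsWeightVector D (-(J.w j ϖ)) (K.vecOf s j k)}

/-- The tuples `k` whose vector is a non-zero multiple of the extremal vector of weight
`-s_s w_j ϖ`, the lowest weight vector. -/
def Trail.Tminus (K : Trail J t ϖ V) (s : I) (j : ℕ) : Set (Fin (occ J s j) → ℕ) :=
  {k | IsWeightVector D (-(simpleReflection D s (J.w j ϖ))) (K.vecOf s j k)}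

/-- The tuples `k` whose vector is carried by a suitable power of `e_s` to a non-zero multiple of
the extremal vector of weight `-w_j ϖ`. These are the tuples that give trails trivializing
at `w_j` after left multiplication by a power of `e_s`. -/
def Trail.T (K : Trail J t ϖ V) (s : I) (j : ℕ) : Set (Fin (occ J s j) → ℕ) :=
  {k | ∃ p : ℕ, IsWeightVector D (-(J.w j ϖ)) ((act D V (Gen.e s) ^ p) (K.vecOf s j k))}

/-- The weights `μ_i`: for the first index, the weight of the vector of the trail just before the
first occurrence of `s`; for the others, the weight of the product of the root vectors between two
consecutive occurrences of `s`. -/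
def Trail.mu (K : Trail J t ϖ V) (s : I) (j : ℕ) (i : Fin (occ J s j)) : Module.Dual 𝕜 H :=
  (if i.val = 0 then K.weight 0 else 0) +
    ∑ p ∈ (Finset.range j).filter (fun p => J.letter p ≠ s ∧ occ J s p = i.val),
      K.exponent p • D.root (J.letter p)

/-- The integers `a_i = -μ_i (α_s^∨)`; see `Trail.a_spec`. -/
def Trail.a (K : Trail J t ϖ V) (s : I) (j : ℕ) (i : Fin (occ J s j)) : ℤ :=
  (if i.val = 0 then (if s = t then 1 else 0) - D.A s t else 0) -
    ∑ p ∈ (Finset.range j).filter (fun p => J.letter p ≠ s ∧ occ J s p = i.val),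
      (K.exponent p : ℤ) * D.A s (J.letter p)

theorem Trail.a_spec (hϖ : IsFundamentalWeight D t ϖ) (K : Trail J t ϖ V) (s : I) (j : ℕ)
    (i : Fin (occ J s j)) : (K.a s j i : 𝕜) = -(K.mu s j i (D.coroot s)) := by
  have h0 : (K.weight 0) (D.coroot s) = (D.A s t : 𝕜) - (if s = t then 1 else 0) := by
    rw [K.start]
    simp [simpleReflection, hϖ s, hϖ t, D.root_coroot]
  have h1 : (∑ p ∈ (Finset.range j).filter (fun p => J.letter p ≠ s ∧ occ J s p = i.val),
      K.exponent p • D.root (J.letter p)) (D.coroot s) =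
      ∑ p ∈ (Finset.range j).filter (fun p => J.letter p ≠ s ∧ occ J s p = i.val),
        (K.exponent p : 𝕜) * (D.A s (J.letter p) : 𝕜) := by
    rw [LinearMap.sum_apply]
    refine Finset.sum_congr rfl fun p _ => ?_
    simp [D.root_coroot]
  unfold Trail.a Trail.mu
  rw [LinearMap.add_apply, h1]
  split_ifs with hi hs
  · rw [h0]; simp only [if_pos hs]; push_cast; ring
  · rw [h0]; simp only [if_neg hs]; push_cast; ring
  · simp

end Trails

/-! ### The convex set -/

/-- The partial sum `x_1 + ⋯ + x_j` of a tuple. -/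
def psum {n : ℕ} (x : Fin n → ℤ) (j : ℕ) : ℤ := ∑ i : Fin n, if i.val < j then x i else 0

/-- The coefficients `c_j` defined by `a` and `l`. -/
def coeffC {n : ℕ} (a : Fin n → ℤ) (l : Fin n → ℕ) (j : ℕ) : ℤ :=
  psum a j - psum (fun i => (l i : ℤ)) j - psum (fun i => (l i : ℤ)) (j - 1)

/-- The coordinates of the tuple `k` relative to `l`: the `j`-th one is
`(k_1 + ⋯ + k_j) - (l_1 + ⋯ + l_j)`. -/
def coord {n : ℕ} (l k : Fin n → ℕ) (j : ℕ) : ℤ :=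
  psum (fun i => (k i : ℤ)) j - psum (fun i => (l i : ℤ)) j

/-- `x < y` are neighbours, in the natural order, among the elements of `S`. -/
def Consecutive {m : ℕ} (S : Set (Fin m)) (x y : Fin m) : Prop :=
  x ∈ S ∧ y ∈ S ∧ x < y ∧ ∀ z ∈ S, ¬ (x < z ∧ z < y)

/-- The convex set defined by the coefficients `c` and an enumeration `u` of their indices. In the
`j`-th step, `u j` is compared with its neighbours in the set of the first `j` indices in the
enumeration. -/
def convexK {m : ℕ} (c : Fin m → ℤ) (u : Equiv.Perm (Fin m)) : Set (Fin m → ℚ) :=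
  {d | (∀ j, 0 ≤ d j ∧ d j ≤ c j) ∧
    ∀ j, (∀ y, Consecutive (u '' Set.Iic j) (u j) y → d y - d (u j) ≥ -((c (u j) : ℚ) - c y)) ∧
      (∀ x, Consecutive (u '' Set.Iic j) x (u j) → d (u j) - d x ≥ 0)}

/-- The integer points of the convex set whose last coordinate is zero. -/
def integralKminus {m : ℕ} (c : Fin m → ℤ) (u : Equiv.Perm (Fin m)) : Set (Fin m → ℤ) :=
  {d | (fun j => (d j : ℚ)) ∈ convexK c u ∧ ∀ j : Fin m, j.val + 1 = m → d j = 0}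

end KMTrail

open KMTrail

/-! Write `k^(i)` for partial sums of exponents at `s`, and call a word a product of the powers of
the trail in which the exponents at `s` are free. Let `v₁` be the first vector of the trail. A tuple
of `T` becomes a tuple of `T⁺` when its last exponent is increased, which only increases partial
sums, so it is enough to bound `T⁺`.

The main case is that words ending just after an occurrence of `s` kill `f_s v₁`. Since `f_s`
commutes with the powers at other letters, applying it to a word on `v₁` then gives a combination of
words with one exponent at `s` lowered by one (`f_word`). Two consequences follow from the
representation theory of `sl₂`.

Lower bound (`Trail.exists_mem_Tminus`): the reflected weight is reached from a vector of `T⁺` by a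
power of `f_s` or of `e_s` that does not kill it. This yields a tuple of `T⁻` whose first `n - 1`
entries are no larger. By hypothesis `c'_i ≥ 0` on `T⁻` for `i < n`, so `k^(i) ≥ ℓ^(i)` on `T⁺` for
`i < n`.

Upper bound (`Trail.total_le_aSum_sub`): just after the `i`-th occurrence of `s` the `s`-weight is
`m = 2k^(i) - a^(i)`. If the bound failed, `m` would be positive, and the vector would lie in the
image under `e_s^m` of words of total exponent `k^(i) - m = a^(i) - k^(i)`. One of these words,
followed by the remaining factors, gives a tuple of `T⁺` whose `(i-1)`-st partial sum is at most
`a^(i) - k^(i) < ℓ^(i-1)`, against the lower bound.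

It remains to see that `f_s v₁` is killed. For `s ≠ t` it is already zero. For `s = t` it lies in
the lowest weight space, and is killed by the first non-trivial power at a letter other than `t` if
this precedes every occurrence of `t`. Otherwise there is a contradiction: either `c_1 < 0` although
`T⁻` is non-empty, or the trail never moves, which is incompatible with the existence of `T⁻` tuples
when `n = 1` and with reducedness when `n ≥ 2`. -/

namespace KMTrail

/-! ### Operators satisfying the relations of `sl₂` -/

section SlTwo

variable {𝕜 V : Type*} [Field 𝕜] [AddCommGroup V] [Module 𝕜 V]

/-- The operators `e`, `f`, `h` satisfy the relations of `sl₂`. -/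
structure SlTwoOps (e f h : Module.End 𝕜 V) : Prop where
  e_f : ∀ v, e (f v) = f (e v) + h v
  h_e : ∀ v, h (e v) = e (h v) + (2 : 𝕜) • e v
  h_f : ∀ v, h (f v) = f (h v) - (2 : 𝕜) • f v

variable {e f h : Module.End 𝕜 V}

theorem SlTwoOps.symm (T : SlTwoOps e f h) : SlTwoOps f e (-h) where
  e_f v := by rw [T.e_f, LinearMap.neg_apply]; abel
  h_e v := by simp only [LinearMap.neg_apply, T.h_f, map_neg]; abel
  h_f v := by simp only [LinearMap.neg_apply, T.h_e, map_neg]; abel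

theorem pow_apply_eigen {e h : Module.End 𝕜 V} {τ : 𝕜} (he : ∀ v, h (e v) = e (h v) + τ • e v)
    {r : 𝕜} {v : V} (hv : h v = r • v) (n : ℕ) : h ((e ^ n) v) = (r + n * τ) • (e ^ n) v := by
  induction n with
  | zero => simp [hv]
  | succ n ih =>
    rw [pow_succ', Module.End.mul_apply, he, ih, map_smul, ← add_smul]
    congr 1; push_cast; ring

theorem SlTwoOps.h_e_pow (T : SlTwoOps e f h) {r : 𝕜} {v : V} (hv : h v = r • v) (n : ℕ) :
    h ((e ^ n) v) = (r + 2 * n) • (e ^ n) v := by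
  rw [pow_apply_eigen T.h_e hv, mul_comm]

theorem SlTwoOps.h_f_pow (T : SlTwoOps e f h) {r : 𝕜} {v : V} (hv : h v = r • v) (n : ℕ) :
    h ((f ^ n) v) = (r - 2 * n) • (f ^ n) v := by
  rw [pow_apply_eigen (τ := -2) (fun v => by rw [T.h_f, neg_smul, sub_eq_add_neg]) hv]
  congr 1; ring

theorem SlTwoOps.e_f_pow (T : SlTwoOps e f h) {r : 𝕜} {v : V} (hv : h v = r • v) (n : ℕ) :
    e ((f ^ (n + 1)) v) = (f ^ (n + 1)) (e v) + ((n + 1) * (r - n)) • (f ^ n) v := by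
  induction n with
  | zero => simp [T.e_f, hv]
  | succ n ih =>
    have hs : ∀ (m : ℕ) (u : V), f ((f ^ m) u) = (f ^ (m + 1)) u := fun m u => by
      rw [pow_succ', Module.End.mul_apply]
    rw [← hs (n + 1) v, T.e_f, ih, T.h_f_pow hv, map_add, map_smul, hs, hs, add_assoc, ← add_smul]
    congr 2; push_cast; ring

theorem SlTwoOps.f_e_pow (T : SlTwoOps e f h) {r : 𝕜} {v : V} (hv : h v = r • v) (n : ℕ) :
    f ((e ^ (n + 1)) v) = (e ^ (n + 1)) (f v) - ((n + 1) * (r + n)) • (e ^ n) v := by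
  rw [T.symm.e_f_pow (r := -r) (by simp [hv])]
  module

variable [CharZero 𝕜]

/-- On a vector of weight `m ≥ 0` on which `e` is nilpotent, `f ^ m` does not vanish. -/
theorem SlTwoOps.eq_zero_of_f_pow (T : SlTwoOps e f h) (Q : ℕ) : ∀ (m : ℕ) (v : V),
    h v = (m : 𝕜) • v → (e ^ Q) v = 0 → (f ^ m) v = 0 → v = 0 := by
  induction Q with
  | zero => intro m v _ h0 _; simpa using h0
  | succ Q ih =>
    intro m v hv hQ hf
    have hf1 : (f ^ (m + 1)) v = 0 := by rw [pow_succ', Module.End.mul_apply, hf, map_zero]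
    have hf2 : (f ^ (m + 2)) v = 0 := by rw [pow_succ', Module.End.mul_apply, hf1, map_zero]
    -- `e v` has weight `m + 2` and smaller nilpotency order; commuting `e` past `f ^ (m + 2)` shows
    -- that `f ^ (m + 2)` kills it.
    have hev : e v = 0 := by
      refine ih (m + 2) (e v) ?_ ?_ ?_
      · rw [T.h_e, hv, map_smul, ← add_smul]; push_cast; rfl
      · rwa [pow_succ, Module.End.mul_apply] at hQ
      · have := T.e_f_pow hv (m + 1)
        rw [hf2, hf1, map_zero, smul_zero, add_zero] at this
        exact this.symm
    -- Now `v` is killed by `e`, and `e` brings `f ^ (n + 1) v` back to `(n + 1)(m - n) f ^ n v`,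
    -- with non-zero scalar as long as `n < m`.
    have key : ∀ n ≤ m, (f ^ n) v = 0 → v = 0 := by
      intro n
      induction n with
      | zero => intro _ h0; simpa using h0
      | succ n ihn =>
        intro hn h0
        refine ihn (by omega) ?_
        have := T.e_f_pow hv n
        rw [h0, hev, map_zero, map_zero, zero_add] at this
        refine (smul_eq_zero.mp this.symm).resolve_left (mul_ne_zero ?_ ?_)
        · exact_mod_cast Nat.succ_ne_zero n
        · rw [sub_ne_zero]; exact_mod_cast (by omega : m ≠ n)
    exact key m le_rfl hf

theorem SlTwoOps.exists_e_pow_f_pow (T : SlTwoOps e f h) {d : ℕ} {w : V}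
    (hw : h w = (d : 𝕜) • w) (hew : e w = 0) (b : ℕ) : ∀ a, a + b ≤ d →
    ∃ c : 𝕜, c ≠ 0 ∧ (e ^ a) ((f ^ (a + b)) w) = c • (f ^ b) w := by
  intro a
  induction a with
  | zero => exact fun _ => ⟨1, one_ne_zero, by simp⟩
  | succ a ih =>
    intro hab
    obtain ⟨c, hc, h1⟩ := ih (by omega)
    refine ⟨((a + b : ℕ) + 1) * ((d : 𝕜) - (a + b : ℕ)) * c, mul_ne_zero (mul_ne_zero ?_ ?_) hc, ?_⟩
    · exact_mod_cast Nat.succ_ne_zero (a + b)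
    · rw [sub_ne_zero]; exact_mod_cast (by omega : d ≠ a + b)
    · rw [show a + 1 + b = a + b + 1 by omega, pow_succ, Module.End.mul_apply, T.e_f_pow hw, hew,
        map_zero, zero_add, map_smul, h1, smul_smul]

/-- In a graded family stable under `e` and `f`, a vector of weight `m ≥ 0` on which `e` is
nilpotent is in the image of `e ^ m`. -/
theorem SlTwoOps.exists_e_pow_eq (T : SlTwoOps e f h) (N : ℤ → Submodule 𝕜 V)
    (hNe : ∀ t, ∀ v ∈ N t, e v ∈ N (t + 1)) (hNf : ∀ t, ∀ v ∈ N t, f v ∈ N (t - 1))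
    (m : ℕ) (t : ℤ) (Q : ℕ) : ∀ v ∈ N t, h v = (m : 𝕜) • v → (e ^ Q) v = 0 →
    ∃ z ∈ N (t - m), (e ^ m) z = v := by
  have hNe' : ∀ (n : ℕ) (t : ℤ), ∀ v ∈ N t, (e ^ n) v ∈ N (t + n) := by
    intro n t v hv
    induction n with
    | zero => simpa using hv
    | succ n ih =>
      rw [pow_succ', Module.End.mul_apply]
      simpa [add_assoc] using hNe _ _ ih
  have hNf' : ∀ (n : ℕ) (t : ℤ), ∀ v ∈ N t, (f ^ n) v ∈ N (t - n) := by
    intro n t v hv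
    induction n with
    | zero => simpa using hv
    | succ n ih =>
      rw [pow_succ', Module.End.mul_apply]
      simpa [sub_sub] using hNf _ _ ih
  induction Q with
  | zero => exact fun v _ _ h0 => ⟨0, zero_mem _, by simpa using h0.symm⟩
  | succ Q ih =>
    intro v hvN hv hQ
    have hw : h ((e ^ Q) v) = ((m + 2 * Q : ℕ) : 𝕜) • (e ^ Q) v := by
      rw [T.h_e_pow hv]; push_cast; rfl
    have hew : e ((e ^ Q) v) = 0 := by rwa [← Module.End.mul_apply, ← pow_succ']
    obtain ⟨c, hc, h1⟩ := T.exists_e_pow_f_pow hw hew 0 Q (by omega)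
    obtain ⟨c', hc', h2⟩ := T.exists_e_pow_f_pow hw hew Q m (by omega)
    rw [add_zero, pow_zero, Module.End.one_apply] at h1
    have hwN := hNe' Q t v hvN
    -- Subtracting the component in the string of the highest weight vector `e ^ Q v` leaves a
    -- vector killed by `e ^ Q`; the subtracted part is itself in the image of `e ^ m`, with
    -- preimage along the same string.
    obtain ⟨z, hz, hzv⟩ := ih (v - c⁻¹ • (f ^ Q) ((e ^ Q) v))
      (sub_mem hvN (Submodule.smul_mem _ _ (by simpa using hNf' Q _ _ hwN)))
      (by
        rw [map_sub, map_smul, T.h_f_pow hw, hv]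
        push_cast; module)
      (by rw [map_sub, map_smul, h1, smul_smul, inv_mul_cancel₀ hc, one_smul, sub_self])
    refine ⟨z + (c⁻¹ * c'⁻¹) • (f ^ (m + Q)) ((e ^ Q) v), add_mem hz (Submodule.smul_mem _ _ ?_), ?_⟩
    · have := hNf' (m + Q) _ _ hwN
      rwa [show t + (Q : ℤ) - ((m + Q : ℕ) : ℤ) = t - m by push_cast; ring] at this
    · rw [map_add, map_smul, h2, hzv, smul_smul, mul_assoc, inv_mul_cancel₀ hc', mul_one,
        sub_add_cancel]

end SlTwo

/-! ### Words with prescribed powers of one operator -/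

section Words

variable {𝕜 V : Type*} [Field 𝕜] [AddCommGroup V] [Module 𝕜 V]

/-- The product of the first `p` operators of a sequence, in which those at the positions in `B`
are successively `e ^ k 0`, `e ^ k 1`, … and that at another position `q` is `X q`. -/
noncomputable def word (e : Module.End 𝕜 V) (X : ℕ → Module.End 𝕜 V) (B : ℕ → Prop)
    [DecidablePred B] (k : ℕ → ℕ) : ℕ → Module.End 𝕜 V
  | 0 => 1
  | p + 1 => (if B p then e ^ k (Nat.count B p) else X p) * word e X B k p

variable (e : Module.End 𝕜 V) (X : ℕ → Module.End 𝕜 V) {f h : Module.End 𝕜 V} (B : ℕ → Prop)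
  [DecidablePred B] (k : ℕ → ℕ)

/-- The sum of the first `n` values. -/
def total (k : ℕ → ℕ) (n : ℕ) : ℕ := ∑ c ∈ Finset.range n, k c

theorem total_succ (n : ℕ) : total k (n + 1) = total k n + k n := Finset.sum_range_succ _ _

theorem total_congr {k k' : ℕ → ℕ} {n : ℕ} (hk : ∀ c < n, k c = k' c) : total k n = total k' n :=
  Finset.sum_congr rfl fun c hc => hk c (Finset.mem_range.mp hc)

theorem total_le {k k' : ℕ → ℕ} {n : ℕ} (hk : ∀ c < n, k c ≤ k' c) : total k n ≤ total k' n :=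
  Finset.sum_le_sum fun c hc => hk c (Finset.mem_range.mp hc)

theorem total_mono {n m : ℕ} (hnm : n ≤ m) : total k n ≤ total k m :=
  Finset.sum_le_sum_of_subset (Finset.range_mono hnm)

theorem total_update (n r : ℕ) :
    total (Function.update k n r) n = total k n :=
  total_congr fun c hc => by rw [Function.update_of_ne (by omega)]

variable {B} in
theorem word_succ_of_mem {p : ℕ} (hp : B p) (v : V) :
    word e X B k (p + 1) v = (e ^ k (Nat.count B p)) (word e X B k p v) := by
  simp [word, hp]

variable {B} in
theorem word_succ_of_notMem {p : ℕ} (hp : ¬ B p) (v : V) :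
    word e X B k (p + 1) v = X p (word e X B k p v) := by
  simp [word, hp]

theorem word_congr {k k' : ℕ → ℕ} : ∀ {p : ℕ}, (∀ c < Nat.count B p, k c = k' c) →
    word e X B k p = word e X B k' p
  | 0, _ => rfl
  | p + 1, hk => by
    have ih := word_congr (p := p) fun c hc =>
      hk c (hc.trans_le (Nat.count_monotone B (Nat.le_succ p)))
    by_cases hp : B p
    · simp only [word, if_pos hp, ih]
      rw [hk _ ((Nat.count_lt_count_succ_iff).mpr hp)]
    · simp only [word, if_neg hp, ih]

/-- The last factors of a word only depend on the last exponents. -/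
theorem exists_word_eq_mul {p j : ℕ} (hpj : p ≤ j) : ∃ C : Module.End 𝕜 V, ∀ k' : ℕ → ℕ,
    (∀ c, Nat.count B p ≤ c → k' c = k c) → word e X B k' j = C * word e X B k' p := by
  induction j, hpj using Nat.le_induction with
  | base => exact ⟨1, fun _ _ => (one_mul _).symm⟩
  | succ j hpj ih =>
    obtain ⟨C, hC⟩ := ih
    refine ⟨(if B j then e ^ k (Nat.count B j) else X j) * C, fun k' hk' => ?_⟩
    rw [word, hC k' hk', hk' _ (Nat.count_monotone B hpj), mul_assoc]

variable {B} in
theorem e_pow_word {p : ℕ} (hp : B p) (r : ℕ) (v : V) :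
    (e ^ r) (word e X B k (p + 1) v) = word e X B
      (Function.update k (Nat.count B p) (k (Nat.count B p) + r)) (p + 1) v := by
  rw [word_succ_of_mem _ _ _ hp, word_succ_of_mem _ _ _ hp, Function.update_self,
    ← Module.End.mul_apply, ← pow_add, add_comm r]
  congr 2
  exact word_congr _ _ _ fun c hc => by rw [Function.update_of_ne (by omega)]

theorem h_word {τ : 𝕜} {ξ : ℕ → 𝕜} (he : ∀ v, h (e v) = e (h v) + τ • e v)
    (hX : ∀ p, ¬ B p → ∀ v, h (X p v) = X p (h v) + ξ p • X p v) {r : 𝕜} {v : V}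
    (hv : h v = r • v) (p : ℕ) : h (word e X B k p v) =
      (r + (∑ q ∈ (Finset.range p).filter (fun q => ¬ B q), ξ q) + total k (Nat.count B p) * τ) •
        word e X B k p v := by
  induction p with
  | zero => simp [word, hv, total]
  | succ p ih =>
    by_cases hp : B p
    · rw [word_succ_of_mem _ _ _ hp, pow_apply_eigen he ih, Nat.count_succ, if_pos hp, total_succ,
        Finset.range_add_one, Finset.filter_insert, if_neg (not_not.mpr hp)]
      congr 1; push_cast; ring
    · rw [word_succ_of_notMem _ _ _ hp, hX p hp, ih, map_smul, ← add_smul, Nat.count_succ,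
        if_neg hp, Finset.range_add_one, Finset.filter_insert, if_pos hp,
        Finset.sum_insert (by simp)]
      congr 1; rw [add_zero]; ring

/-- The words obtained by lowering the exponents by `m` in total. -/
def lowered (v : V) (p m : ℕ) : Set V :=
  {y | ∃ k' : ℕ → ℕ, (∀ c, k' c ≤ k c) ∧
    total k' (Nat.count B p) + m = total k (Nat.count B p) ∧ y = word e X B k' p v}

/-- Moving `f` to the right costs nothing at the factors `X p`. At a factor `e ^ (m + 1)` it
produces a scalar multiple of `e ^ m`, because the vector on which the factor acts is an eigenvector
of `h`. -/
theorem f_word (T : SlTwoOps e f h) {ξ : ℕ → 𝕜}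
    (hXh : ∀ p, ¬ B p → ∀ v, h (X p v) = X p (h v) + ξ p • X p v)
    (hXf : ∀ p, ¬ B p → ∀ v, f (X p v) = X p (f v)) {r : 𝕜} {v : V} (hv : h v = r • v)
    (p : ℕ) : f (word e X B k p v) - word e X B k p (f v) ∈
      Submodule.span 𝕜 (lowered e X B k v p 1) := by
  induction p with
  | zero => simp [word]
  | succ p ih =>
    have hw := h_word e X B k T.h_e hXh hv p
    set w := word e X B k p v
    by_cases hp : B p
    · set n := Nat.count B p with hn
      have hcount : Nat.count B (p + 1) = n + 1 := by rw [Nat.count_succ, if_pos hp]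
      have h1 : (e ^ k n) (f w - word e X B k p (f v)) ∈
          Submodule.span 𝕜 (lowered e X B k v (p + 1) 1) := by
        have := Submodule.mem_map_of_mem (f := e ^ k n) ih
        rw [Submodule.map_span] at this
        refine Submodule.span_mono ?_ this
        rintro _ ⟨_, ⟨k', hk', htot, rfl⟩, rfl⟩
        refine ⟨Function.update k' n (k n), fun c => ?_, ?_, ?_⟩
        · by_cases hc : c = n
          · subst hc; simp
          · rw [Function.update_of_ne hc]; exact hk' c
        · rw [← hn] at htot
          rw [hcount, total_succ, total_succ, total_update, Function.update_self, ← htot]; omega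
        · rw [word_succ_of_mem _ _ _ hp, ← hn, Function.update_self]
          congr 2
          exact word_congr _ _ _ fun c hc => by rw [Function.update_of_ne (by omega)]
      rw [word_succ_of_mem _ _ _ hp, word_succ_of_mem _ _ _ hp, ← hn]
      rcases hkn : k n with _ | m
      · simpa [hkn] using h1
      · have h2 : (e ^ m) w ∈ lowered e X B k v (p + 1) 1 := by
          refine ⟨Function.update k n m, fun c => ?_, ?_, ?_⟩
          · by_cases hc : c = n
            · subst hc; simp [hkn]
            · rw [Function.update_of_ne hc]
          · rw [hcount, total_succ, total_succ, total_update, Function.update_self, hkn]; omega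
          · rw [word_succ_of_mem _ _ _ hp, ← hn, Function.update_self]
            rw [word_congr e X B (k := Function.update k n m) (k' := k)
              fun c hc => by rw [Function.update_of_ne (by omega)]]
        rw [hkn] at h1
        rw [T.f_e_pow hw, sub_right_comm, ← map_sub]
        exact sub_mem h1 (Submodule.smul_mem _ _ (Submodule.subset_span h2))
    · have hcount : Nat.count B (p + 1) = Nat.count B p := by
        rw [Nat.count_succ, if_neg hp, add_zero]
      rw [word_succ_of_notMem _ _ _ hp, word_succ_of_notMem _ _ _ hp, hXf p hp, ← map_sub]
      have := Submodule.mem_map_of_mem (f := X p) ih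
      rw [Submodule.map_span] at this
      refine Submodule.span_mono ?_ this
      rintro _ ⟨_, ⟨k', hk', htot, rfl⟩, rfl⟩
      exact ⟨k', hk', by rwa [hcount], (word_succ_of_notMem _ _ _ hp _).symm⟩

/-- Only exponents below `k` occur when `f_word` is iterated, so the boundary term need only vanish
for those. -/
theorem f_pow_word (T : SlTwoOps e f h) {ξ : ℕ → 𝕜}
    (hXh : ∀ p, ¬ B p → ∀ v, h (X p v) = X p (h v) + ξ p • X p v)
    (hXf : ∀ p, ¬ B p → ∀ v, f (X p v) = X p (f v)) {r : 𝕜} {v : V} (hv : h v = r • v)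
    (p : ℕ) (hk : ∀ k' : ℕ → ℕ, (∀ c, k' c ≤ k c) → word e X B k' p (f v) = 0) (m : ℕ) :
    (f ^ m) (word e X B k p v) ∈ Submodule.span 𝕜 (lowered e X B k v p m) := by
  induction m with
  | zero => exact Submodule.subset_span ⟨k, fun _ => le_rfl, rfl, by simp⟩
  | succ m ih =>
    have := Submodule.mem_map_of_mem (f := f) ih
    rw [Submodule.map_span] at this
    rw [pow_succ', Module.End.mul_apply]
    refine (Submodule.span_le (p := Submodule.span 𝕜 (lowered e X B k v p (m + 1)))).mpr ?_ this
    rintro _ ⟨_, ⟨k', hk', htot, rfl⟩, rfl⟩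
    have h1 := f_word e X B k' T hXh hXf hv p
    rw [hk k' hk', sub_zero] at h1
    refine Submodule.span_mono ?_ h1
    rintro _ ⟨k'', hk'', htot', rfl⟩
    exact ⟨k'', fun c => (hk'' c).trans (hk' c), by omega, rfl⟩

end Words

/-! ### Relations in the Kac-Moody algebra and weights of lowest weight modules -/

section Relations

variable {𝕜 I H : Type*} [Field 𝕜] [DecidableEq I] [AddCommGroup H] [Module 𝕜 H]
variable (D : Datum 𝕜 I H)

/-- The projection of the free Lie algebra on the Kac-Moody algebra. -/
noncomputable def proj : FreeLieAlgebra 𝕜 (Gen I H) →ₗ⁅𝕜⁆ KacMoody D where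
  toFun x := LieSubmodule.Quotient.mk (LieSubmodule.Quotient.mk x : Aux D)
  map_add' _ _ := rfl
  map_smul' _ _ := rfl
  map_lie' := rfl

theorem proj_surjective : Function.Surjective (proj D) := by
  intro x
  obtain ⟨y, rfl⟩ := LieSubmodule.Quotient.surjective_mk' _ x
  obtain ⟨z, rfl⟩ := LieSubmodule.Quotient.surjective_mk' _ y
  exact ⟨z, rfl⟩

variable {D} in
theorem proj_eq_zero {x : FreeLieAlgebra 𝕜 (Gen I H)} (hx : IsRelator D x) : proj D x = 0 := by
  have h : (LieSubmodule.Quotient.mk x : Aux D) = 0 :=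
    LieSubmodule.Quotient.mk_eq_zero'.mpr (LieSubmodule.subset_lieSpan hx)
  change (LieSubmodule.Quotient.mk (LieSubmodule.Quotient.mk x : Aux D) : KacMoody D) = 0
  rw [h]; rfl

variable (V : Type*) [AddCommGroup V] [Module 𝕜 V]
  [LieRingModule (KacMoody D) V] [LieModule 𝕜 (KacMoody D) V]

theorem act_lie (g g' : Gen I H) (v : V) :
    ⁅proj D ⁅freeGen 𝕜 g, freeGen 𝕜 g'⁆, v⁆ = act D V g (act D V g' v) - act D V g' (act D V g v) := by
  rw [LieHom.map_lie, lie_lie]; rfl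

variable {V}

theorem act_e_f (i j : I) (v : V) : act D V (.e i) (act D V (.f j) v) =
    act D V (.f j) (act D V (.e i) v) + if i = j then act D V (.h (D.coroot i)) v else 0 := by
  have h := congr_arg (fun x => ⁅x, v⁆) (proj_eq_zero (IsRelator.e_f (D := D) i j))
  simp only [map_sub, sub_lie, act_lie, zero_lie] at h
  rw [sub_eq_zero, sub_eq_iff_eq_add'] at h
  rw [h]
  split_ifs
  · rfl
  · simp

theorem act_h_e (x : H) (i : I) (v : V) : act D V (.h x) (act D V (.e i) v) =
    act D V (.e i) (act D V (.h x) v) + D.root i x • act D V (.e i) v := by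
  have h := congr_arg (fun x => ⁅x, v⁆) (proj_eq_zero (IsRelator.h_e (D := D) x i))
  simp only [map_sub, sub_lie, act_lie, zero_lie, map_smul, smul_lie] at h
  rw [sub_eq_zero, sub_eq_iff_eq_add'] at h
  exact h

theorem act_h_f (x : H) (i : I) (v : V) : act D V (.h x) (act D V (.f i) v) =
    act D V (.f i) (act D V (.h x) v) - D.root i x • act D V (.f i) v := by
  have h := congr_arg (fun x => ⁅x, v⁆) (proj_eq_zero (IsRelator.h_f (D := D) x i))
  simp only [map_add, add_lie, act_lie, zero_lie, map_smul, smul_lie] at h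
  rw [add_eq_zero_iff_eq_neg, sub_eq_iff_eq_add'] at h
  rw [h, sub_eq_add_neg]; rfl

theorem act_h_h (x y : H) (v : V) : act D V (.h x) (act D V (.h y) v) =
    act D V (.h y) (act D V (.h x) v) := by
  have h := congr_arg (fun x => ⁅x, v⁆) (proj_eq_zero (IsRelator.h_h (D := D) x y))
  simp only [act_lie, zero_lie] at h
  rwa [sub_eq_zero] at h

theorem slTwoOps (i : I) : SlTwoOps (act D V (.e i)) (act D V (.f i))
    (act D V (.h (D.coroot i))) where
  e_f v := by rw [act_e_f, if_pos rfl]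
  h_e v := by rw [act_h_e, D.root_coroot, D.diag]; norm_num
  h_f v := by rw [act_h_f, D.root_coroot, D.diag]; norm_num

theorem act_f_e_pow {i j : I} (hij : i ≠ j) (n : ℕ) (v : V) :
    act D V (.f j) ((act D V (.e i) ^ n) v) = (act D V (.e i) ^ n) (act D V (.f j) v) := by
  induction n with
  | zero => simp
  | succ n ih =>
    have := act_e_f D i j ((act D V (.e i) ^ n) v)
    rw [if_neg hij, add_zero] at this
    rw [pow_succ', Module.End.mul_apply, Module.End.mul_apply, ← this, ih]

/-- `v` is zero or a weight vector of weight `μ`. -/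
def IsEigen (μ : Module.Dual 𝕜 H) (v : V) : Prop := ∀ x : H, act D V (.h x) v = μ x • v

variable {D}

theorem IsEigen.e_pow {μ : Module.Dual 𝕜 H} {v : V} (hv : IsEigen D μ v) (i : I) (n : ℕ) :
    IsEigen D (μ + n • D.root i) ((act D V (.e i) ^ n) v) := fun x => by
  rw [pow_apply_eigen (act_h_e D x i) (hv x)]; simp

theorem IsEigen.f_pow {μ : Module.Dual 𝕜 H} {v : V} (hv : IsEigen D μ v) (i : I) (n : ℕ) :
    IsEigen D (μ - n • D.root i) ((act D V (.f i) ^ n) v) := fun x => by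
  rw [pow_apply_eigen (τ := -D.root i x)
    (fun v => by rw [act_h_f, neg_smul, sub_eq_add_neg]) (hv x)]
  congr 1; simp [sub_eq_add_neg]

theorem IsEigen.e {μ : Module.Dual 𝕜 H} {v : V} (hv : IsEigen D μ v) (i : I) :
    IsEigen D (μ + D.root i) (act D V (.e i) v) := by simpa using hv.e_pow i 1

theorem IsEigen.f {μ : Module.Dual 𝕜 H} {v : V} (hv : IsEigen D μ v) (i : I) :
    IsEigen D (μ - D.root i) (act D V (.f i) v) := by simpa using hv.f_pow i 1

theorem IsEigen.unique {μ ν : Module.Dual 𝕜 H} {v : V} (hμ : IsEigen D μ v) (hν : IsEigen D ν v)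
    (hv : v ≠ 0) : μ = ν :=
  LinearMap.ext fun x => smul_left_injective 𝕜 hv ((hμ x).symm.trans (hν x))

/-- A subspace stable under the generators is stable under the Kac-Moody algebra. -/
theorem lie_mem_of_act_mem {N : Submodule 𝕜 V} (hN : ∀ g, ∀ v ∈ N, act D V g v ∈ N)
    (x : KacMoody D) {v : V} (hv : v ∈ N) : ⁅x, v⁆ ∈ N := by
  let S : LieSubalgebra 𝕜 (KacMoody D) :=
    { carrier := {x | ∀ v ∈ N, ⁅x, v⁆ ∈ N}
      add_mem' := fun ha hb v hv => by rw [add_lie]; exact add_mem (ha v hv) (hb v hv)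
      zero_mem' := fun v _ => by rw [zero_lie]; exact zero_mem _
      smul_mem' := fun c a ha v hv => by rw [smul_lie]; exact N.smul_mem c (ha v hv)
      lie_mem' := fun {a b} ha hb v hv => by
        rw [lie_lie]; exact sub_mem (ha _ (hb v hv)) (hb _ (ha v hv)) }
  let φ : FreeLieAlgebra 𝕜 (Gen I H) →ₗ⁅𝕜⁆ S :=
    FreeLieAlgebra.lift 𝕜 fun g => ⟨gen D g, fun v hv => hN g v hv⟩
  have hφ : S.incl.comp φ = proj D := FreeLieAlgebra.hom_ext fun g => by
    rw [LieHom.comp_apply, FreeLieAlgebra.lift_of_apply]; rfl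
  obtain ⟨y, rfl⟩ := proj_surjective D x
  rw [← hφ]
  exact (φ y).2 v hv

/-- The words in the `e i` applied to `v₀` span a subspace stable under all generators: commuting `f
i` to the right leaves only `h` terms, and `f i` kills `v₀`. Hence this subspace is everything. -/
theorem span_e_words {v₀ : V} {μ : Module.Dual 𝕜 H} (hv₀ : IsEigen D μ v₀)
    (hf : ∀ i, act D V (.f i) v₀ = 0) (hspan : LieSubmodule.lieSpan 𝕜 (KacMoody D) {v₀} = ⊤) :
    Submodule.span 𝕜 {y : V | ∃ β ∈ AddSubmonoid.closure (Set.range D.root),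
      IsEigen D (μ + β) y} = ⊤ := by
  let W : List I → V := fun l => l.foldr (fun i v => act D V (.e i) v) v₀
  have hW : ∀ l, ∃ β ∈ AddSubmonoid.closure (Set.range D.root), IsEigen D (μ + β) (W l) := by
    intro l
    induction l with
    | nil => exact ⟨0, zero_mem _, by rw [add_zero]; exact hv₀⟩
    | cons i l ih =>
      obtain ⟨β, hβ, h⟩ := ih
      refine ⟨β + D.root i, add_mem hβ (AddSubmonoid.subset_closure ⟨i, rfl⟩), ?_⟩
      rw [← add_assoc]
      exact h.e i
  let N : Submodule 𝕜 V := Submodule.span 𝕜 (Set.range W)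
  have hWN : ∀ l, W l ∈ N := fun l => Submodule.subset_span ⟨l, rfl⟩
  have hstable : ∀ T : Module.End 𝕜 V, (∀ l, T (W l) ∈ N) → ∀ v ∈ N, T v ∈ N := by
    intro T hT v hv
    have : N ≤ N.comap T := Submodule.span_le.mpr (by rintro _ ⟨l, rfl⟩; exact hT l)
    exact this hv
  have he : ∀ i, ∀ v ∈ N, act D V (.e i) v ∈ N := fun i => hstable _ fun l => hWN (i :: l)
  have hh : ∀ x, ∀ v ∈ N, act D V (.h x) v ∈ N := fun x => hstable _ fun l => by
    obtain ⟨β, _, h⟩ := hW l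
    rw [h x]; exact N.smul_mem _ (hWN l)
  have hfN : ∀ i, ∀ v ∈ N, act D V (.f i) v ∈ N := fun i => hstable _ fun l => by
    induction l with
    | nil => change act D V (.f i) v₀ ∈ N; rw [hf]; exact zero_mem _
    | cons j l ih =>
      have := act_e_f D j i (W l)
      rw [← sub_eq_iff_eq_add] at this
      change act D V (.f i) (act D V (.e j) (W l)) ∈ N
      rw [← this]
      refine sub_mem (he _ _ ih) ?_
      split_ifs
      · exact hh _ _ (hWN l)
      · exact zero_mem _
  have htop : ∀ v, v ∈ N := by
    intro v
    let N' : LieSubmodule 𝕜 (KacMoody D) V :=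
      { N with
        lie_mem := fun {x v} hv => lie_mem_of_act_mem (N := N)
          (fun g => by cases g <;> simp_all) x hv }
    have hle : LieSubmodule.lieSpan 𝕜 (KacMoody D) {v₀} ≤ N' :=
      LieSubmodule.lieSpan_le.mpr (by rintro _ rfl; exact hWN [])
    exact hle (hspan ▸ LieSubmodule.mem_top v)
  rw [eq_top_iff]
  intro v _
  refine Submodule.span_mono ?_ (htop v)
  rintro _ ⟨l, rfl⟩
  exact hW l

/-- The weights of a lowest weight module are obtained by adding simple roots to the lowest
weight. -/
theorem eq_zero_of_isEigen {ϖ : Module.Dual 𝕜 H} (hV : IsIntegrableLowestWeight D V (-ϖ))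
    {μ : Module.Dual 𝕜 H} {v : V} (hv : IsEigen D μ v)
    (hμ : μ + ϖ ∉ AddSubmonoid.closure (Set.range D.root)) : v = 0 := by
  obtain ⟨v₀, hv₀, hf, hspan⟩ := hV.lowest
  -- Joint generalized eigenspaces of the commuting operators `h x` are independent, so a weight
  -- vector cannot lie in the span of the other weight spaces unless it is zero.
  have hmem : ∀ (χ : Module.Dual 𝕜 H) (y : V), IsEigen D χ y →
      y ∈ ⨅ x : H, (act D V (.h x)).maxGenEigenspace (χ x) := by
    intro χ y hy
    rw [Module.End.mem_iInf_maxGenEigenspace_iff]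
    exact fun x => ⟨1, by simp [hy x]⟩
  have hind := Module.End.independent_iInf_maxGenEigenspace_of_forall_mapsTo
    (fun x : H => act D V (.h x)) (fun x y φ =>
      Module.End.mapsTo_maxGenEigenspace_of_comm (LinearMap.ext fun v => act_h_h D y x v) φ)
  have hdis := Submodule.disjoint_def.mp (hind fun x => μ x) v (hmem μ v hv)
  refine hdis ?_
  have hle : Submodule.span 𝕜 {y : V | ∃ β ∈ AddSubmonoid.closure (Set.range D.root),
      IsEigen D (-ϖ + β) y} ≤ ⨆ (χ : H → 𝕜) (_ : χ ≠ fun x => μ x),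
        ⨅ x : H, (act D V (.h x)).maxGenEigenspace (χ x) := by
    refine Submodule.span_le.mpr ?_
    rintro y ⟨β, hβ, hy⟩
    refine Submodule.mem_iSup_of_mem (fun x => (-ϖ + β) x)
      (Submodule.mem_iSup_of_mem (fun h => hμ ?_) (hmem _ y hy))
    rw [show μ = -ϖ + β from LinearMap.ext fun x => (congr_fun h x).symm]
    simpa using hβ
  exact hle (by rw [span_e_words hv₀.2 hf hspan]; trivial)

variable (D)

/-- The coefficients at a simple root. -/
theorem exists_coeff (i : I) : ∃ φ : Module.Dual 𝕜 H →ₗ[𝕜] 𝕜,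
    ∀ j, φ (D.root j) = if j = i then 1 else 0 := by
  let b := Module.Basis.span D.root_indep
  obtain ⟨φ, hφ⟩ := (b.coord i).exists_extend
  refine ⟨φ, fun j => ?_⟩
  have h1 : ((b j : Submodule.span 𝕜 (Set.range D.root)) : Module.Dual 𝕜 H) = D.root j :=
    congr_arg Subtype.val (Module.Basis.span_apply D.root_indep j)
  rw [← h1]
  change (φ.comp (Submodule.subtype _)) (b j) = _
  rw [hφ, Module.Basis.coord_apply, Module.Basis.repr_self, Finsupp.single_apply]

theorem coeff_mem_range {i : I} {φ : Module.Dual 𝕜 H →ₗ[𝕜] 𝕜}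
    (hφ : ∀ j, φ (D.root j) = if j = i then 1 else 0) {β : Module.Dual 𝕜 H}
    (hβ : β ∈ AddSubmonoid.closure (Set.range D.root)) : ∃ n : ℕ, φ β = n := by
  induction hβ using AddSubmonoid.closure_induction with
  | mem x hx =>
    obtain ⟨j, rfl⟩ := hx
    refine ⟨if j = i then 1 else 0, ?_⟩
    rw [hφ]; split_ifs <;> simp
  | zero => exact ⟨0, by simp⟩
  | add x y _ _ hx hy =>
    obtain ⟨n, hn⟩ := hx
    obtain ⟨m, hm⟩ := hy
    exact ⟨n + m, by rw [map_add, hn, hm]; push_cast; rfl⟩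

variable {D} in
theorem simpleReflection_fundamental {t : I} {ϖ : Module.Dual 𝕜 H}
    (hϖ : IsFundamentalWeight D t ϖ) (i : I) :
    simpleReflection D i ϖ = ϖ - if i = t then D.root t else 0 := by
  change ϖ - ϖ (D.coroot i) • D.root i = _
  rw [hϖ i]
  split_ifs with h
  · rw [h, one_smul]
  · rw [zero_smul]

variable [CharZero 𝕜]

/-- A linear functional reading off the coefficient at `D.root i` takes natural values on the cone.
-/
theorem nonneg_of_smul_root_add_mem {i : I} {z : ℤ} {β : Module.Dual 𝕜 H}
    (h : z • D.root i + β ∈ AddSubmonoid.closure (Set.range D.root))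
    (hβ : ∀ φ : Module.Dual 𝕜 H →ₗ[𝕜] 𝕜, (∀ j, φ (D.root j) = if j = i then 1 else 0) →
      φ β = 0) : 0 ≤ z := by
  obtain ⟨φ, hφ⟩ := exists_coeff D i
  obtain ⟨n, hn⟩ := coeff_mem_range D hφ h
  rw [map_add, hβ φ hφ, map_zsmul, hφ, if_pos rfl, add_zero, zsmul_one] at hn
  have : z = n := by exact_mod_cast hn
  omega

theorem neg_root_notMem (i : I) : -D.root i ∉ AddSubmonoid.closure (Set.range D.root) := by
  intro h
  have := nonneg_of_smul_root_add_mem D (i := i) (z := -1) (β := 0) (by simpa using h) (by simp)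
  omega

variable {D}
variable {t : I} {ϖ : Module.Dual 𝕜 H}

/-- The integer `m` is the `i`-weight of `e_i v`. If this vector were non-zero, `f_i ^ m` would
carry it to a non-zero vector of the reflected weight, which is not a weight of `V`. -/
theorem act_e_eq_zero (hV : IsIntegrableLowestWeight D V (-ϖ)) {μ : Module.Dual 𝕜 H} {v : V}
    (hv : IsEigen D μ v) (i : I) (m : ℕ) (hm : μ (D.coroot i) + 2 = m)
    (hμ : μ + D.root i - m • D.root i + ϖ ∉ AddSubmonoid.closure (Set.range D.root)) :
    act D V (.e i) v = 0 := by
  obtain ⟨Q, hQ⟩ := hV.e_nilpotent i (act D V (.e i) v)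
  refine (slTwoOps D i).eq_zero_of_f_pow Q m _ ?_ hQ
    (eq_zero_of_isEigen hV ((hv.e i).f_pow i m) hμ)
  rw [hv.e i (D.coroot i), LinearMap.add_apply, D.root_coroot, D.diag, ← hm]
  norm_num

/-- The other raising operators kill the lowest weight space. -/
theorem act_e_lowest (hϖ : IsFundamentalWeight D t ϖ) (hV : IsIntegrableLowestWeight D V (-ϖ))
    {v : V} (hv : IsEigen D (-ϖ) v) {i : I} (hi : i ≠ t) : act D V (.e i) v = 0 := by
  refine act_e_eq_zero hV hv i 2 ?_ ?_
  · simp [hϖ i, hi]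
  · convert neg_root_notMem D i using 2
    rw [two_smul]; abel

theorem act_e_start (hϖ : IsFundamentalWeight D t ϖ) (hV : IsIntegrableLowestWeight D V (-ϖ))
    {v : V} (hv : IsEigen D (-simpleReflection D t ϖ) v) : act D V (.e t) v = 0 := by
  rw [simpleReflection_fundamental hϖ, if_pos rfl] at hv
  refine act_e_eq_zero hV hv t 3 ?_ ?_
  · simp [hϖ t, D.root_coroot, D.diag]; norm_num
  · convert neg_root_notMem D t using 2
    rw [show (3 : ℕ) = 1 + 1 + 1 from rfl, add_smul, add_smul, one_smul]; abel

/-- The resulting weight would be `-ϖ + α_t - α_s`, with a negative coefficient at `α_s`. -/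
theorem act_f_start (hϖ : IsFundamentalWeight D t ϖ) (hV : IsIntegrableLowestWeight D V (-ϖ))
    {v : V} (hv : IsEigen D (-simpleReflection D t ϖ) v) {s : I} (hs : s ≠ t) :
    act D V (.f s) v = 0 := by
  rw [simpleReflection_fundamental hϖ, if_pos rfl] at hv
  refine eq_zero_of_isEigen hV (hv.f s) fun h => ?_
  have := nonneg_of_smul_root_add_mem D (i := s) (z := -1) (β := D.root t)
    (by convert h using 1; rw [neg_one_zsmul]; abel)
    (fun φ hφ => by rw [hφ, if_neg hs.symm])
  omega

end Relations

/-! ### Trails of type `s` -/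

section PartialSums

/-- The extension of a tuple by zero. -/
def extendZero {n : ℕ} (k : Fin n → ℕ) (c : ℕ) : ℕ := if h : c < n then k ⟨c, h⟩ else 0

theorem extendZero_of_lt {n : ℕ} (k : ℕ → ℕ) {c : ℕ} (hc : c < n) :
    extendZero (fun i : Fin n => k i) c = k c := by
  simp [extendZero, hc]

theorem restrict_extendZero {n : ℕ} (k : Fin n → ℕ) :
    (fun i : Fin n => extendZero k i) = k := by
  funext i; simp [extendZero]

theorem sum_ite_fin {n i : ℕ} (hi : i ≤ n) (g : ℕ → ℤ) :
    (∑ c : Fin n, if c.val < i then g c else 0) = ∑ c ∈ Finset.range i, g c := by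
  rw [Fin.sum_univ_eq_sum_range (fun c => if c < i then g c else 0) n, ← Finset.sum_filter]
  congr 1
  ext c
  simp only [Finset.mem_filter, Finset.mem_range]
  omega

theorem psum_restrict {n i : ℕ} (hi : i ≤ n) (k : ℕ → ℕ) :
    psum (fun c : Fin n => (k c : ℤ)) i = total k i := by
  rw [psum, sum_ite_fin hi (fun c => (k c : ℤ)), total, Nat.cast_sum]

theorem psum_eq_total {n i : ℕ} (hi : i ≤ n) (k : Fin n → ℕ) :
    psum (fun c => (k c : ℤ)) i = total (extendZero k) i := by
  rw [← psum_restrict hi]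
  congr 1
  funext c
  exact congr_arg Nat.cast (congr_fun (restrict_extendZero k) c).symm

theorem total_eq_add (k : ℕ → ℕ) {i n : ℕ} (hi : i ≤ n) :
    total k n = total k i + ∑ c ∈ Finset.Ico i n, k c :=
  (Finset.sum_range_add_sum_Ico k hi).symm

end PartialSums

/-! ### Words along a trail and the two bounds on partial sums -/

section Ladders

variable {𝕜 I H : Type*} [Field 𝕜] [DecidableEq I] [AddCommGroup H] [Module 𝕜 H]
variable {D : Datum 𝕜 I H} {J : ReducedSeq D} {t : I} {ϖ : Module.Dual 𝕜 H}
variable {V : Type*} [AddCommGroup V] [Module 𝕜 V]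
  [LieRingModule (KacMoody D) V] [LieModule 𝕜 (KacMoody D) V]
variable (K : Trail J t ϖ V) (s : I)

/-- The product of the first `p` powers of simple root vectors, those at the letter `s` having the
exponents `k 0`, `k 1`, …, and the others those of the trail. -/
noncomputable def Trail.op (k : ℕ → ℕ) (p : ℕ) : Module.End 𝕜 V :=
  word (act D V (.e s)) (fun q => act D V (.e (J.letter q)) ^ K.exponent q)
    (fun q => J.letter q = s) k p

theorem Trail.vecOf_eq (j : ℕ) (k : Fin (occ J s j) → ℕ) :
    K.vecOf s j k = K.op s (extendZero k) j (K.vec 0) := by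
  have h : ∀ p, ladder J (K.newExponent s j k) (K.vec 0) p =
      K.op s (extendZero k) p (K.vec 0) := by
    intro p
    induction p with
    | zero => rfl
    | succ p ih =>
      by_cases hp : J.letter p = s
      · rw [Trail.op, word_succ_of_mem _ _ _ hp, ← Trail.op, ← ih, ladder, Trail.newExponent,
          if_pos hp, hp]
        rfl
      · rw [Trail.op, word_succ_of_notMem _ _ _ hp, ← Trail.op, ← ih, ladder, Trail.newExponent,
          if_neg hp]
  exact h j

theorem Trail.vecOf_restrict (j : ℕ) (k : ℕ → ℕ) :
    K.vecOf s j (fun i => k i) = K.op s k j (K.vec 0) := by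
  rw [K.vecOf_eq]
  exact DFunLike.congr_fun (word_congr _ _ (fun p => J.letter p = s)
    fun c hc => extendZero_of_lt k hc) (K.vec 0)

theorem IsEigen.congr_weight {μ ν : Module.Dual 𝕜 H} {v : V} (hv : IsEigen D μ v) (h : μ = ν) :
    IsEigen D ν v := h ▸ hv

theorem act_h_e_pow (x : H) (i : I) (n : ℕ) (v : V) :
    act D V (.h x) ((act D V (.e i) ^ n) v) = (act D V (.e i) ^ n) (act D V (.h x) v) +
      (n * D.root i x) • (act D V (.e i) ^ n) v := by
  induction n with
  | zero => simp
  | succ n ih =>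
    rw [pow_succ', Module.End.mul_apply, act_h_e, ih, map_add, map_smul, Module.End.mul_apply]
    push_cast
    module

theorem Trail.isEigen_start : IsEigen D (-simpleReflection D t ϖ) (K.vec 0) :=
  K.start ▸ (K.isWeight 0 (by simp)).2

theorem Trail.isEigen_op (k : ℕ → ℕ) (p : ℕ) :
    IsEigen D (-simpleReflection D t ϖ +
      (∑ q ∈ (Finset.range p).filter (fun q => ¬ J.letter q = s),
        K.exponent q • D.root (J.letter q)) + total k (occ J s p) • D.root s)
      (K.op s k p (K.vec 0)) := fun x => by
  rw [Trail.op, h_word (h := act D V (.h x)) _ _ _ _ (act_h_e D x s)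
    (fun q _ v => act_h_e_pow x (J.letter q) (K.exponent q) v) (K.isEigen_start x)]
  congr 1
  simp

/-- The opposite of the value at the coroot of `s` of the weight of the ladder, the contribution of
the exponents at `s` being left out. -/
def Trail.aSum (p : ℕ) : ℤ := (if s = t then 1 else 0) - D.A s t -
  ∑ q ∈ (Finset.range p).filter (fun q => ¬ J.letter q = s), (K.exponent q : ℤ) * D.A s (J.letter q)

/-- Positions with a letter other than `s` are grouped by the number of earlier occurrences of `s`;
the `i`-th partial sum collects exactly those before the `i`-th occurrence. -/
theorem Trail.psum_a {q j : ℕ} (hq : q < j) (hqs : J.letter q = s) :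
    psum (K.a s j) (occ J s (q + 1)) = K.aSum s (q + 1) := by
  have hi : occ J s (q + 1) ≤ occ J s j := Nat.count_monotone _ hq
  have hpos : occ J s (q + 1) = occ J s q + 1 := by rw [occ, Nat.count_succ, if_pos hqs]
  set g : ℕ → ℤ := fun c => (if c = 0 then (if s = t then 1 else 0) - D.A s t else 0) -
    ∑ p ∈ (Finset.range j).filter (fun p => J.letter p ≠ s ∧ occ J s p = c),
      (K.exponent p : ℤ) * D.A s (J.letter p)
  change (∑ c : Fin (occ J s j), if c.val < occ J s (q + 1) then g c else 0) = _
  rw [sum_ite_fin hi, Finset.sum_sub_distrib, Finset.sum_ite_eq' (Finset.range _) 0,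
    if_pos (by rw [hpos]; simp), Trail.aSum]
  congr 1
  have hmaps : ∀ p ∈ (Finset.range (q + 1)).filter (fun p => ¬ J.letter p = s),
      occ J s p ∈ Finset.range (occ J s (q + 1)) := by
    intro p hp
    rw [Finset.mem_filter, Finset.mem_range] at hp
    rw [Finset.mem_range, hpos]
    exact Nat.lt_succ_of_le (Nat.count_monotone _ (by omega))
  rw [← Finset.sum_fiberwise_of_maps_to hmaps]
  refine Finset.sum_congr rfl fun c hc => Finset.sum_congr ?_ fun _ _ => rfl
  rw [Finset.mem_range] at hc
  ext p
  simp only [Finset.mem_filter, Finset.mem_range]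
  constructor
  · rintro ⟨_, hps, hpc⟩
    refine ⟨⟨?_, hps⟩, hpc⟩
    by_contra hlt
    have : occ J s (q + 1) ≤ occ J s p := Nat.count_monotone _ (by omega)
    omega
  · rintro ⟨⟨hpq, hps⟩, hpc⟩
    exact ⟨by omega, hps, hpc⟩

theorem Trail.h_op (hϖ : IsFundamentalWeight D t ϖ) (k : ℕ → ℕ) (p : ℕ) :
    act D V (.h (D.coroot s)) (K.op s k p (K.vec 0)) =
      ((2 * total k (occ J s p) - K.aSum s p : ℤ) : 𝕜) • K.op s k p (K.vec 0) := by
  rw [K.isEigen_op s k p (D.coroot s), simpleReflection_fundamental hϖ, if_pos rfl]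
  congr 1
  simp only [LinearMap.add_apply, LinearMap.neg_apply, LinearMap.sub_apply, hϖ s, D.root_coroot,
    LinearMap.sum_apply, LinearMap.smul_apply, nsmul_eq_mul, D.diag, Trail.aSum]
  push_cast
  ring

variable {s}

theorem Trail.e_pow_op {q : ℕ} (hqs : J.letter q = s) (k : ℕ → ℕ) (r : ℕ) (v : V) :
    (act D V (.e s) ^ r) (K.op s k (q + 1) v) = K.op s
      (Function.update k (occ J s q) (k (occ J s q) + r)) (q + 1) v :=
  e_pow_word (B := fun q => J.letter q = s) _ _ _ hqs r v

theorem act_f_letter_pow {q : ℕ} (hq : ¬ J.letter q = s) (n : ℕ) (v : V) :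
    act D V (.f s) ((act D V (.e (J.letter q)) ^ n) v) =
      (act D V (.e (J.letter q)) ^ n) (act D V (.f s) v) :=
  act_f_e_pow D hq n v

theorem occ_succ {q : ℕ} (hqs : J.letter q = s) : occ J s (q + 1) = occ J s q + 1 := by
  rw [occ, Nat.count_succ, if_pos hqs]

variable [CharZero 𝕜]

/-- A ladder that ends in the highest weight of the extremal `s`-string can be lowered to the lowest
weight of that string. -/
theorem Trail.exists_mem_Tminus (hϖ : IsFundamentalWeight D t ϖ)
    (hV : IsIntegrableLowestWeight D V (-ϖ)) {q : ℕ} (hqs : J.letter q = s) {k : ℕ → ℕ}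
    (hk : (fun i : Fin (occ J s (q + 1)) => k i) ∈ K.Tplus s (q + 1))
    (hf : ∀ k' : ℕ → ℕ, (∀ c, k' c ≤ k c) → K.op s k' (q + 1) (act D V (.f s) (K.vec 0)) = 0) :
    ∃ k' : ℕ → ℕ, (fun i : Fin (occ J s (q + 1)) => k' i) ∈ K.Tminus s (q + 1) ∧
      ∀ c < occ J s q, k' c ≤ k c := by
  have hk' : IsWeightVector D (-(J.w (q + 1) ϖ)) (K.op s k (q + 1) (K.vec 0)) := by
    rw [← K.vecOf_restrict]; exact hk
  obtain ⟨hy0, hy⟩ := hk'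
  have hμ := IsEigen.unique hy (K.isEigen_op s k (q + 1)) hy0
  have hh := K.h_op s hϖ k (q + 1)
  have hz := smul_left_injective 𝕜 hy0 ((hy (D.coroot s)).symm.trans hh)
  have hrefl : -(simpleReflection D s (J.w (q + 1) ϖ)) = -(J.w (q + 1) ϖ) -
      (2 * total k (occ J s (q + 1)) - K.aSum s (q + 1)) • D.root s := by
    have h2 : (J.w (q + 1) ϖ) (D.coroot s) =
        -((2 * total k (occ J s (q + 1)) - K.aSum s (q + 1) : ℤ) : 𝕜) := by
      simpa using congr_arg Neg.neg hz
    change -(J.w (q + 1) ϖ - (J.w (q + 1) ϖ) (D.coroot s) • D.root s) = _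
    rw [h2, ← Int.cast_smul_eq_zsmul 𝕜]
    module
  set z : ℤ := 2 * total k (occ J s (q + 1)) - K.aSum s (q + 1)
  -- The weight of a word depends only on its total exponent at `s`, so only non-vanishing and the
  -- total have to be checked.
  have conclude : ∀ k' : ℕ → ℕ, K.op s k' (q + 1) (K.vec 0) ≠ 0 →
      (total k' (occ J s (q + 1)) + z : ℤ) = total k (occ J s (q + 1)) →
      (fun i : Fin (occ J s (q + 1)) => k' i) ∈ K.Tminus s (q + 1) := by
    intro k' h0 htot
    change IsWeightVector D _ _
    rw [K.vecOf_restrict]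
    refine ⟨h0, ?_⟩
    have := K.isEigen_op s k' (q + 1)
    rw [hrefl, hμ, ← natCast_zsmul, ← htot]
    rw [← natCast_zsmul] at this
    exact this.congr_weight (by module)
  -- `z` is the `s`-weight of the ladder. If it is `m ≥ 0`, `f_s ^ m` does not kill the vector, so
  -- one of the lowered words is non-zero.
  obtain ⟨m, hm | hm⟩ := z.eq_nat_or_neg
  · have hspan := f_pow_word (f := act D V (.f s)) _ _ _ k (slTwoOps D s)
      (fun q _ v => act_h_e_pow (D.coroot s) (J.letter q) (K.exponent q) v)
      (fun q hq v => act_f_letter_pow hq (K.exponent q) v) (K.isEigen_start (D.coroot s))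
      (q + 1) hf m
    by_contra hcon
    push Not at hcon
    have hzero : lowered (act D V (.e s)) (fun q => act D V (.e (J.letter q)) ^ K.exponent q)
        (fun q => J.letter q = s) k (K.vec 0) (q + 1) m ⊆ {0} := by
      rintro y ⟨k', hle, htot, rfl⟩
      by_contra h0
      obtain ⟨c, _, hc⟩ := hcon k' (conclude k' h0 (by rw [hm]; exact_mod_cast htot))
      exact absurd (hle c) (by omega)
    have hfm := Submodule.span_mono hzero hspan
    rw [Submodule.span_singleton_eq_bot.mpr rfl, Submodule.mem_bot] at hfm
    obtain ⟨Q, hQ⟩ := hV.e_nilpotent s (K.op s k (q + 1) (K.vec 0))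
    exact hy0 ((slTwoOps D s).eq_zero_of_f_pow Q m _ (by rw [hh, hm]; simp) hQ hfm)
  -- If `z = -m`, the reflected weight lies higher: `e_s ^ m` does not kill the vector, and it is
  -- absorbed in the last exponent, leaving the earlier ones unchanged.
  · refine ⟨Function.update k (occ J s q) (k (occ J s q) + m), conclude _ ?_ ?_, fun c hc => ?_⟩
    · rw [← K.e_pow_op hqs]
      intro h0
      obtain ⟨Q, hQ⟩ := hV.f_nilpotent s (K.op s k (q + 1) (K.vec 0))
      refine hy0 ((slTwoOps D s).symm.eq_zero_of_f_pow Q m _ ?_ hQ h0)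
      rw [LinearMap.neg_apply, hh, hm]; simp
    · rw [hm, occ_succ hqs, total_succ, total_succ, total_update, Function.update_self]
      push_cast; ring
    · rw [Function.update_of_ne (by omega)]

/-- If the partial sums of the exponents of all ladders that end in the extremal weight are at
least `b` before an occurrence of `s`, then they are bounded above after it. -/
theorem Trail.total_le_aSum_sub (hϖ : IsFundamentalWeight D t ϖ)
    (hV : IsIntegrableLowestWeight D V (-ϖ)) {q j : ℕ} (hq : q < j) (hqs : J.letter q = s)
    (hf : ∀ k' : ℕ → ℕ, K.op s k' (q + 1) (act D V (.f s) (K.vec 0)) = 0) {b : ℕ}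
    (hb : ∀ k' : ℕ → ℕ, (fun i : Fin (occ J s j) => k' i) ∈ K.Tplus s j →
      b ≤ total k' (occ J s q)) {k : ℕ → ℕ}
    (hk : (fun i : Fin (occ J s j) => k i) ∈ K.Tplus s j) :
    (total k (occ J s (q + 1)) : ℤ) ≤ K.aSum s (q + 1) - b := by
  by_contra! hlt
  have hbk := hb k hk
  have hmono := total_mono k (Nat.count_monotone (fun p => J.letter p = s) (Nat.le_add_right q 1))
  -- Non-negative because `total k` after the occurrence is at least `b` and, by `hlt`, exceeds
  -- `aSum - b`.
  obtain ⟨m, hm⟩ : ∃ m : ℕ, 2 * total k (occ J s (q + 1)) - K.aSum s (q + 1) = (m : ℤ) :=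
    Int.eq_ofNat_of_zero_le (by simp only [occ] at *; omega)
  have hk' : IsWeightVector D (-(J.w j ϖ)) (K.op s k j (K.vec 0)) := by
    rw [← K.vecOf_restrict]; exact hk
  obtain ⟨hy0, hy⟩ := hk'
  -- Grading by total exponent at `s`, so that the preimage under `e_s ^ m` found below is a
  -- combination of words of known total.
  let N : ℤ → Submodule 𝕜 V := fun r => Submodule.span 𝕜
    {y | ∃ k' : ℕ → ℕ, (total k' (occ J s (q + 1)) : ℤ) = r ∧ y = K.op s k' (q + 1) (K.vec 0)}
  have hNe : ∀ r, ∀ v ∈ N r, act D V (.e s) v ∈ N (r + 1) := by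
    intro r v hv
    have : N r ≤ (N (r + 1)).comap (act D V (.e s)) := by
      refine Submodule.span_le.mpr ?_
      rintro _ ⟨k', rfl, rfl⟩
      refine Submodule.subset_span
        ⟨Function.update k' (occ J s q) (k' (occ J s q) + 1), ?_, ?_⟩
      · rw [occ_succ hqs, total_succ, total_succ, total_update, Function.update_self]
        push_cast; ring
      · rw [← K.e_pow_op hqs, pow_one]
    exact this hv
  have hNf : ∀ r, ∀ v ∈ N r, act D V (.f s) v ∈ N (r - 1) := by
    intro r v hv
    have : N r ≤ (N (r - 1)).comap (act D V (.f s)) := by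
      refine Submodule.span_le.mpr ?_
      rintro _ ⟨k', rfl, rfl⟩
      have h1 := f_word (f := act D V (.f s)) _ _ _ k' (slTwoOps D s)
        (fun q _ v => act_h_e_pow (D.coroot s) (J.letter q) (K.exponent q) v)
        (fun q hq v => act_f_letter_pow hq (K.exponent q) v) (K.isEigen_start (D.coroot s)) (q + 1)
      have h2 := hf k'
      rw [Trail.op] at h2
      rw [h2, sub_zero] at h1
      refine Submodule.span_mono ?_ h1
      rintro _ ⟨k'', _, htot, rfl⟩
      exact ⟨k'', by simp only [occ]; omega, rfl⟩
    exact this hv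
  obtain ⟨Q, hQ⟩ := hV.e_nilpotent s (K.op s k (q + 1) (K.vec 0))
  obtain ⟨z, hz, hzy⟩ := (slTwoOps D s).exists_e_pow_eq N hNe hNf m
    (total k (occ J s (q + 1))) Q _ (Submodule.subset_span ⟨k, rfl, rfl⟩)
    (by rw [K.h_op s hϖ, hm]; simp) hQ
  obtain ⟨C, hC⟩ := exists_word_eq_mul (act D V (.e s))
    (fun q => act D V (.e (J.letter q)) ^ K.exponent q) (fun q => J.letter q = s) k
    (Nat.succ_le_of_lt hq)
  have hCk : K.op s k j (K.vec 0) = C ((act D V (.e s) ^ m) z) := by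
    rw [hzy, Trail.op, hC k fun _ _ => rfl]; rfl
  -- Since `C e_s ^ m` does not kill the combination `z`, it does not kill some word in it.
  obtain ⟨k', htot, hne⟩ : ∃ k' : ℕ → ℕ, (total k' (occ J s (q + 1)) : ℤ) =
      total k (occ J s (q + 1)) - m ∧
      C ((act D V (.e s) ^ m) (K.op s k' (q + 1) (K.vec 0))) ≠ 0 := by
    by_contra! hcon
    have : N (total k (occ J s (q + 1)) - m) ≤ LinearMap.ker (C * act D V (.e s) ^ m) := by
      refine Submodule.span_le.mpr ?_
      rintro _ ⟨k', h1, rfl⟩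
      exact hcon k' h1
    exact hy0 (hCk.trans (this hz))
  rw [K.e_pow_op hqs] at hne
  set κ := Function.update k' (occ J s q) (k' (occ J s q) + m) with hκ
  have hκtot : (total κ (occ J s (q + 1)) : ℤ) = total k (occ J s (q + 1)) := by
    rw [occ_succ hqs, total_succ] at htot
    rw [hκ, occ_succ hqs, total_succ, total_update, Function.update_self]
    push_cast at htot ⊢
    omega
  -- The new exponents up to this occurrence are joined to the old ones after it; the totals agree,
  -- hence so do the weights at the end.
  let k'' : ℕ → ℕ := fun c => if c < occ J s (q + 1) then κ c else k c
  have hlow : ∀ c < occ J s (q + 1), k'' c = κ c := fun c hc => if_pos hc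
  have hhigh : ∀ c, occ J s (q + 1) ≤ c → k'' c = k c := fun c hc => if_neg (by omega)
  have hij : occ J s (q + 1) ≤ occ J s j := Nat.count_monotone _ hq
  have hmem : (fun i : Fin (occ J s j) => k'' i) ∈ K.Tplus s j := by
    change IsWeightVector D _ _
    rw [K.vecOf_restrict]
    refine ⟨?_, ?_⟩
    · rw [Trail.op, hC k'' hhigh, word_congr _ _ _ hlow]
      exact hne
    · have h1 : total k'' (occ J s j) = total k (occ J s j) := by
        rw [total_eq_add k'' hij, total_eq_add k hij, total_congr hlow]
        congr 1
        · exact_mod_cast hκtot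
        · exact Finset.sum_congr rfl fun c hc => hhigh c (Finset.mem_Ico.mp hc).1
      have h2 := K.isEigen_op s k'' j
      rwa [h1, ← IsEigen.unique hy (K.isEigen_op s k j) hy0] at h2
  -- Now `b ≤ total k' (occ J s q) ≤ total k' (occ J s (q + 1))`, and the last term is `aSum - total
  -- k (occ J s (q + 1)) < b`.
  have h3 := hb k'' hmem
  have h4 : total k'' (occ J s q) = total k' (occ J s q) := by
    rw [total_congr fun c hc => hlow c (hc.trans_le (by rw [occ_succ hqs]; omega)), hκ,
      total_update]
  have h5 := total_mono k' (Nat.count_monotone (fun p => J.letter p = s) (Nat.le_add_right q 1))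
  simp only [occ] at *
  omega

end Ladders

/-! ### Reduced words and commuting reflections -/

section Reduced

variable {𝕜 I H : Type*} [Field 𝕜] [AddCommGroup H] [Module 𝕜 H] {D : Datum 𝕜 I H}

theorem simpleReflection_mul_self (i : I) :
    simpleReflection D i * simpleReflection D i = 1 := by
  refine LinearMap.ext fun μ => ?_
  change (μ - μ (D.coroot i) • D.root i) -
    (μ - μ (D.coroot i) • D.root i) (D.coroot i) • D.root i = μ
  simp only [LinearMap.sub_apply, LinearMap.smul_apply, D.root_coroot, D.diag, smul_eq_mul]
  push_cast
  module

theorem simpleReflection_commute {i j : I} (h : D.A i j = 0) :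
    simpleReflection D i * simpleReflection D j = simpleReflection D j * simpleReflection D i := by
  refine LinearMap.ext fun μ => ?_
  change (μ - μ (D.coroot j) • D.root j) -
    (μ - μ (D.coroot j) • D.root j) (D.coroot i) • D.root i =
    (μ - μ (D.coroot i) • D.root i) -
    (μ - μ (D.coroot i) • D.root i) (D.coroot j) • D.root j
  simp only [LinearMap.sub_apply, LinearMap.smul_apply, D.root_coroot, h, D.zero_symm i j h,
    smul_eq_mul]
  push_cast
  module

theorem exists_word_weylElt (D : Datum 𝕜 I H) (letter : ℕ → I) (p : ℕ) :
    ∃ l : List I, l.length = p ∧ (l.map (simpleReflection D)).prod = weylElt D letter p := by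
  induction p with
  | zero => exact ⟨[], rfl, rfl⟩
  | succ p ih =>
    obtain ⟨l, hl, h⟩ := ih
    exact ⟨letter p :: l, by simp [hl], by simp [h, weylElt]⟩

/-- Between two occurrences of a letter in a reduced sequence there is a letter whose reflection
does not commute with that of the given one. -/
theorem ReducedSeq.exists_A_ne_zero (J : ReducedSeq D) {t : I} {q r : ℕ} (hqr : q < r)
    (hr : ((r + 1 : ℕ) : ℕ∞) ≤ J.len) (hqt : J.letter q = t) (hrt : J.letter r = t) :
    ∃ p, q < p ∧ p < r ∧ D.A (J.letter p) t ≠ 0 := by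
  by_contra! h
  -- If all the reflections in between commute with `s_t`, the factor `s_t` from position `q` can be
  -- kept on the left until it cancels against the one at position `r`.
  have key : ∀ p, q + 1 ≤ p → p ≤ r → ∃ l : List I, l.length + 1 = p ∧
      weylElt D J.letter p = simpleReflection D t * (l.map (simpleReflection D)).prod := by
    intro p hp
    induction p, hp using Nat.le_induction with
    | base =>
      intro _
      obtain ⟨l, hl, hw⟩ := exists_word_weylElt D J.letter q
      exact ⟨l, by rw [hl], by rw [weylElt, hw, hqt]⟩
    | succ p hp ih =>
      intro hpr
      obtain ⟨l, hl, hw⟩ := ih (by omega)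
      refine ⟨J.letter p :: l, by simp [hl], ?_⟩
      rw [weylElt, hw, ← mul_assoc, simpleReflection_commute (h p (by omega) (by omega)),
        mul_assoc, List.map_cons, List.prod_cons]
  obtain ⟨l, hl, hw⟩ := key r hqr le_rfl
  have := J.reduced (r + 1) hr l
    (by rw [weylElt, hw, hrt, ← mul_assoc, simpleReflection_mul_self, one_mul])
  omega

end Reduced

theorem exists_count_eq (B : ℕ → Prop) [DecidablePred B] {c : ℕ} : ∀ {j : ℕ}, c < Nat.count B j →
    ∃ r < j, B r ∧ Nat.count B r = c
  | 0, h => by simp at h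
  | j + 1, h => by
    by_cases hc : c < Nat.count B j
    · obtain ⟨r, hr, h1⟩ := exists_count_eq B hc
      exact ⟨r, by omega, h1⟩
    · rw [Nat.count_succ] at h
      split_ifs at h with hB
      · exact ⟨j, by omega, hB, by omega⟩
      · omega

/-! ### Trails that start with trivial steps, and the upper bounds -/

section Ladders

variable {𝕜 I H : Type*} [Field 𝕜] [DecidableEq I] [AddCommGroup H] [Module 𝕜 H]
variable {D : Datum 𝕜 I H} {J : ReducedSeq D} {t : I} {ϖ : Module.Dual 𝕜 H}
variable {V : Type*} [AddCommGroup V] [Module 𝕜 V]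
  [LieRingModule (KacMoody D) V] [LieModule 𝕜 (KacMoody D) V]
variable (K : Trail J t ϖ V) {s : I}

theorem Trail.op_eq_self {k : ℕ → ℕ} {q : ℕ}
    (hq : ∀ r < q, J.letter r ≠ s → K.exponent r = 0) (hk : ∀ c < occ J s q, k c = 0) (u : V) :
    K.op s k q u = u := by
  induction q with
  | zero => rfl
  | succ q ih =>
    have ih' := ih (fun r hr => hq r (by omega))
      (fun c hc => hk c (hc.trans_le (Nat.count_monotone _ (Nat.le_succ q))))
    by_cases h : J.letter q = s
    · rw [Trail.op, word_succ_of_mem _ _ _ h, ← Trail.op, ih', hk _ (by rw [occ_succ h]; simp)]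
      rfl
    · rw [Trail.op, word_succ_of_notMem _ _ _ h, ← Trail.op, ih', hq q (by omega) h]
      rfl

theorem Trail.op_eq_zero_of_le {k : ℕ → ℕ} {p q : ℕ} (hpq : p ≤ q) {u : V}
    (h : K.op s k p u = 0) : K.op s k q u = 0 := by
  obtain ⟨C, hC⟩ := exists_word_eq_mul (act D V (.e s))
    (fun q => act D V (.e (J.letter q)) ^ K.exponent q) (fun q => J.letter q = s) k hpq
  rw [Trail.op, hC k fun _ _ => rfl, Module.End.mul_apply, ← Trail.op, h, map_zero]

theorem pow_apply_eq_zero {e : Module.End 𝕜 V} {v : V} (h : e v = 0) {n : ℕ} (hn : n ≠ 0) :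
    (e ^ n) v = 0 := by
  obtain ⟨n, rfl⟩ := Nat.exists_eq_succ_of_ne_zero hn
  rw [Nat.succ_eq_add_one, pow_succ, Module.End.mul_apply, h, map_zero]

variable [CharZero 𝕜]

/-- `f_t` brings the first vector into the lowest weight space; nothing moves it before position
`q`, where a positive power of some `e_i` with `i ≠ t` kills it. -/
theorem Trail.op_f_start_eq_zero (hϖ : IsFundamentalWeight D t ϖ)
    (hV : IsIntegrableLowestWeight D V (-ϖ)) {k : ℕ → ℕ} {q p : ℕ} (hqt : J.letter q ≠ t)
    (hq0 : K.exponent q ≠ 0) (hq : ∀ r < q, J.letter r ≠ t → K.exponent r = 0)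
    (hk : ∀ c < occ J t q, k c = 0) (hp : q < p) :
    K.op t k p (act D V (.f t) (K.vec 0)) = 0 := by
  refine K.op_eq_zero_of_le hp ?_
  rw [Trail.op, word_succ_of_notMem _ _ _ hqt, ← Trail.op, K.op_eq_self hq hk]
  refine pow_apply_eq_zero (act_e_lowest hϖ hV ((K.isEigen_start.f t).congr_weight ?_) hqt) hq0
  rw [simpleReflection_fundamental hϖ, if_pos rfl]
  abel

/-- As long as no other letter has moved the first vector, `e_t` kills it, so a positive exponent at
`t` would make the word vanish. -/
theorem Trail.eq_zero_of_op_ne_zero (hϖ : IsFundamentalWeight D t ϖ)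
    (hV : IsIntegrableLowestWeight D V (-ϖ)) {k : ℕ → ℕ} {j : ℕ}
    (hk : K.op t k j (K.vec 0) ≠ 0) {q : ℕ} (hqj : q ≤ j)
    (hq : ∀ r < q, J.letter r ≠ t → K.exponent r = 0) : ∀ c < occ J t q, k c = 0 := by
  induction q with
  | zero => intro c hc; simp at hc
  | succ q ih =>
    have ih' := ih (by omega) fun r hr => hq r (by omega)
    by_cases h : J.letter q = t
    · intro c hc
      rw [occ_succ h] at hc
      rcases Nat.lt_succ_iff_lt_or_eq.mp hc with hc | rfl
      · exact ih' c hc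
      · by_contra hne
        refine hk (K.op_eq_zero_of_le hqj ?_)
        rw [Trail.op, word_succ_of_mem _ _ _ h, ← Trail.op,
          K.op_eq_self (fun r hr => hq r (by omega)) ih']
        exact pow_apply_eq_zero (act_e_start hϖ hV K.isEigen_start) hne
    · rwa [occ, Nat.count_succ, if_neg h, add_zero]

theorem Trail.vec_eq_start (hϖ : IsFundamentalWeight D t ϖ)
    (hV : IsIntegrableLowestWeight D V (-ϖ)) {j : ℕ} (hjJ : (j : ℕ∞) ≤ J.len)
    (hj : ∀ r < j, J.letter r ≠ t → K.exponent r = 0) : ∀ p ≤ j, K.vec p = K.vec 0 := by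
  intro p
  induction p with
  | zero => exact fun _ => rfl
  | succ p ih =>
    intro hp
    have hlt : ((p + 1 : ℕ) : ℕ∞) ≤ J.len := le_trans (by exact_mod_cast hp) hjJ
    have hstep := K.step p (lt_of_lt_of_le (by exact_mod_cast Nat.lt_succ_self p) hlt)
    rw [ih (by omega)] at hstep
    rw [← hstep]
    by_cases h : J.letter p = t
    · by_cases h0 : K.exponent p = 0
      · rw [h0]; rfl
      · refine absurd ?_ (K.isWeight (p + 1) hlt).1
        rw [← hstep, h]
        exact pow_apply_eq_zero (act_e_start hϖ hV K.isEigen_start) h0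
    · rw [hj p (by omega) h]; rfl

/-- A trail that does not move up to the second occurrence of `t` contradicts reducedness. -/
theorem Trail.exists_exponent_ne_zero (hϖ : IsFundamentalWeight D t ϖ)
    (hV : IsIntegrableLowestWeight D V (-ϖ)) {q : ℕ} (hqJ : ((q + 1 : ℕ) : ℕ∞) ≤ J.len)
    (hqt : J.letter q = t) (hocc : occ J t q ≠ 0) :
    ∃ r < q + 1, J.letter r ≠ t ∧ K.exponent r ≠ 0 := by
  by_contra! hzero
  have hvec := K.vec_eq_start hϖ hV hqJ hzero
  obtain ⟨a, haq, hat, ha0⟩ := exists_count_eq (fun p => J.letter p = t) (Nat.pos_of_ne_zero hocc)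
  have hbefore : ∀ r < a, J.letter r ≠ t := Nat.count_iff_forall_not.mp ha0
  obtain ⟨b, hbq, hbt, hb⟩ : ∃ b ≤ q, J.letter b = t ∧ occ J t b = 1 := by
    obtain ⟨b, hb, h1, h2⟩ := exists_count_eq (fun p => J.letter p = t) (c := 1) (j := q + 1)
      (by rw [Nat.count_succ, if_pos hqt]; simp only [occ] at hocc; omega)
    exact ⟨b, by omega, h1, h2⟩
  have hab : a < b := by
    by_contra hle
    have : occ J t b ≤ occ J t a := Nat.count_monotone _ (by omega)
    simp only [occ] at *; omega
  have hbetween : ∀ p, a < p → p < b → J.letter p ≠ t := by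
    intro p hap hpb hpt
    have h1 := Nat.count_strict_mono (p := fun p => J.letter p = t) hat hap
    have h2 := Nat.count_strict_mono (p := fun p => J.letter p = t) hpt hpb
    simp only [occ] at *; omega
  have hlen : ∀ p ≤ q, (p : ℕ∞) < J.len := fun p hp =>
    lt_of_lt_of_le (by exact_mod_cast Nat.lt_succ_of_le hp) hqJ
  have hweight : ∀ p ≤ q, K.weight p = -simpleReflection D t ϖ := fun p hp => by
    have h := K.isWeight p (hlen p hp).le
    have h2 := h.2
    rw [hvec p (by omega)] at h2
    exact IsEigen.unique h2 K.isEigen_start (by rw [← hvec p (by omega)]; exact h.1)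
  have key : ∀ p, a + 1 ≤ p → p ≤ b → drivingWeight J t ϖ p = -simpleReflection D t ϖ ∧
      ∀ r, a < r → r < p → D.A (J.letter r) t = 0 := by
    intro p hp
    induction p, hp using Nat.le_induction with
    | base => exact fun _ => ⟨by rw [drivingWeight, if_pos hbefore], fun r _ _ => by omega⟩
    | succ p hp ih =>
      intro hpb
      obtain ⟨hdr, hA⟩ := ih (by omega)
      have hpt := hbetween p (by omega) (by omega)
      have hnext : drivingWeight J t ϖ (p + 1) =
          -simpleReflection D t ϖ - D.A (J.letter p) t • D.root (J.letter p) := by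
        rw [drivingWeight, if_neg (by push Not; exact ⟨a, by omega, hat⟩), hdr,
          simpleReflection_fundamental hϖ t, if_pos rfl, ← Int.cast_smul_eq_zsmul 𝕜]
        change -(ϖ - D.root t) - (-(ϖ - D.root t)) (D.coroot (J.letter p)) • _ = _
        simp [hϖ (J.letter p), hpt, D.root_coroot]
      -- The trail is still at its first weight, so its difference with the driving weight is `D.A
      -- (J.letter p) t` times a simple root. Positivity of the trail makes this off-diagonal entry
      -- non-negative, hence zero.
      have hA0 : D.A (J.letter p) t = 0 := by
        have hpos := K.positive (p + 1) (hlen (p + 1) (by omega))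
        rw [hnext, hweight (p + 1) (by omega), sub_sub_cancel] at hpos
        exact le_antisymm (D.offDiag_nonpos _ _ hpt)
          (nonneg_of_smul_root_add_mem D (β := 0) (by simpa using hpos) (by simp))
      refine ⟨by rw [hnext, hA0, zero_smul, sub_zero], fun r h1 h2 => ?_⟩
      rcases Nat.lt_succ_iff_lt_or_eq.mp h2 with h2 | rfl
      · exact hA r h1 h2
      · exact hA0
  obtain ⟨p, hap, hpb, hne⟩ := J.exists_A_ne_zero hab
    (le_trans (by exact_mod_cast Nat.succ_le_succ hbq) hqJ) hat hbt
  exact hne ((key b hab le_rfl).2 p hap hpb)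

/-- The upper bounds, when the vector of the trail before the first occurrence of `s` is a lowest
weight vector for `s`. -/
theorem Trail.upper_bounds (hϖ : IsFundamentalWeight D t ϖ)
    (hV : IsIntegrableLowestWeight D V (-ϖ)) {q : ℕ} (hqs : J.letter q = s)
    (hf : ∀ (k' : ℕ → ℕ) (r : ℕ), J.letter r = s →
      K.op s k' (r + 1) (act D V (.f s) (K.vec 0)) = 0)
    (l : Fin (occ J s (q + 1)) → ℕ)
    (hT : ∀ k ∈ K.Tminus s (q + 1), ∀ i ≤ occ J s q, 0 ≤ coord l k i) :
    ∀ k ∈ K.T s (q + 1), ∀ i : ℕ, 1 ≤ i → i ≤ occ J s (q + 1) →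
      psum (fun c => (k c : ℤ)) i ≤
        psum (K.a s (q + 1)) i - psum (fun c => (l c : ℤ)) (i - 1) := by
  have hn : occ J s (q + 1) = occ J s q + 1 := occ_succ hqs
  have hlow : ∀ k : ℕ → ℕ, (fun i : Fin (occ J s (q + 1)) => k i) ∈ K.Tplus s (q + 1) →
      ∀ i ≤ occ J s q, total (extendZero l) i ≤ total k i := by
    intro k hk i hi
    obtain ⟨k', hk', hle⟩ := K.exists_mem_Tminus hϖ hV hqs hk fun k' _ => hf k' q hqs
    have h1 := hT _ hk' i hi
    rw [coord, psum_restrict (by omega), psum_eq_total (by omega)] at h1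
    have h2 : total k' i ≤ total k i := total_le fun c hc => hle c (by omega)
    omega
  rintro k ⟨p, hp⟩ i hi hin
  rw [K.vecOf_eq, K.e_pow_op hqs] at hp
  -- The extra power `e_s ^ p` is absorbed in the last exponent, which turns a tuple of `T` into one
  -- of `T⁺`.
  set κ := Function.update (extendZero k) (occ J s q) (extendZero k (occ J s q) + p) with hκ
  have hκT : (fun i : Fin (occ J s (q + 1)) => κ i) ∈ K.Tplus s (q + 1) := by
    change IsWeightVector D _ _
    rwa [K.vecOf_restrict]
  obtain ⟨r, hrq, hrs, hr⟩ := exists_count_eq (fun p => J.letter p = s) (c := i - 1) (j := q + 1)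
    (by simp only [occ] at *; omega)
  have hri : occ J s (r + 1) = i := by rw [occ_succ hrs]; simp only [occ]; omega
  have h1 := K.total_le_aSum_sub hϖ hV hrq hrs (fun k' => hf k' r hrs)
    (b := total (extendZero l) (i - 1))
    (fun k' hk' => by
      change _ ≤ total k' (Nat.count _ r)
      rw [hr]
      exact hlow k' hk' _ (by omega)) hκT
  rw [← K.psum_a s hrq hrs, hri] at h1
  have h2 : total (extendZero k) i ≤ total κ i := total_le fun c _ => by
    by_cases hc : c = occ J s q
    · subst hc; rw [hκ, Function.update_self]; omega
    · rw [hκ, Function.update_of_ne hc]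
  rw [psum_eq_total hin, psum_eq_total (by omega)]
  omega

end Ladders

end KMTrail

/-! ### The proposition: vanishing on `f_s v₁` and the degenerate cases -/

theorem proposition7p5p7
    {𝕜 I H : Type*} [Field 𝕜] [CharZero 𝕜] [DecidableEq I] [AddCommGroup H] [Module 𝕜 H]
    (D : Datum 𝕜 I H) (J : ReducedSeq D)
    (t : I) (ϖ : Module.Dual 𝕜 H) (hϖ : IsFundamentalWeight D t ϖ)
    (V : Type*) [AddCommGroup V] [Module 𝕜 V]
    [LieRingModule (KacMoody D) V] [LieModule 𝕜 (KacMoody D) V]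
    (hV : IsIntegrableLowestWeight D V (-ϖ))
    -- a trail trivializing at the `n`-th occurrence of `s`, where `n = occ J s j`
    (K : Trail J t ϖ V) (s : I) (j : ℕ) (hj : 1 ≤ j) (hjJ : (j : ℕ∞) ≤ J.len)
    (hs : J.letter (j - 1) = s) (hK : K.TrivializesAt j) (hH : s ≠ t ∨ ¬ K.IsDriving)
    -- the exponents of the minimal trail for the lexicographic order
    (l : Fin (occ J s j) → ℕ) (hl : IsLeast (toLex '' K.Tplus s j) (toLex l))
    -- a total order on the indices that lifts the natural order on the coefficients
    (u : Equiv.Perm (Fin (occ J s j - 1)))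
    (hu : Monotone fun i => coeffC (K.a s j) l ((u i).val + 1))
    (hT : (fun k (i : Fin (occ J s j - 1)) => coord l k (i.val + 1)) '' K.Tminus s j =
      integralKminus (fun i => coeffC (K.a s j) l (i.val + 1)) u) :
    ∀ k ∈ K.T s j, ∀ i : ℕ, 1 ≤ i → i ≤ occ J s j →
      coord l k i ≤ coeffC (K.a s j) l i ∧
      0 ≤ psum (K.a s j) i - psum (fun q => (k q : ℤ)) i - psum (fun q => (l q : ℤ)) (i - 1) := by
  obtain ⟨q, rfl⟩ : ∃ q, j = q + 1 := ⟨j - 1, by omega⟩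
  rw [Nat.add_sub_cancel] at hs
  have hn : occ J s (q + 1) = occ J s q + 1 := occ_succ hs
  have hbound : ∀ k ∈ K.Tminus s (q + 1), ∀ i : Fin (occ J s (q + 1) - 1),
      0 ≤ coord l k (i.val + 1) ∧
        coord l k (i.val + 1) ≤ coeffC (K.a s (q + 1)) l (i.val + 1) := by
    intro k hk i
    have h1 : (fun i : Fin (occ J s (q + 1) - 1) => coord l k (i.val + 1)) ∈
        integralKminus (fun i => coeffC (K.a s (q + 1)) l (i.val + 1)) u :=
      hT ▸ Set.mem_image_of_mem _ hk
    obtain ⟨h2, h3⟩ := h1.1.1 i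
    exact ⟨Int.cast_nonneg_iff.mp h2, Int.cast_le.mp h3⟩
  suffices hf : ∀ (k' : ℕ → ℕ) (r : ℕ), J.letter r = s →
      K.op s k' (r + 1) (act D V (.f s) (K.vec 0)) = 0 by
    intro k hk i hi hin
    have h := K.upper_bounds hϖ hV hs hf l (fun k hk i hi => by
      rcases i with _ | i
      · simp [coord, psum]
      · exact (hbound k hk ⟨i, by omega⟩).1) k hk i hi hin
    simp only [coord, coeffC]
    omega
  by_cases hst : s = t
  swap
  · intro k' r _
    rw [act_f_start hϖ hV K.isEigen_start hst, map_zero]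
  subst hst
  have hlT : IsWeightVector D (-(J.w (q + 1) ϖ)) (K.op s (extendZero l) (q + 1) (K.vec 0)) := by
    obtain ⟨k, hk, hkl⟩ := hl.1
    obtain rfl : k = l := toLex.injective hkl
    rw [← K.vecOf_eq]
    exact hk
  by_cases hex : ∃ r, r < q + 1 ∧ J.letter r ≠ s ∧ K.exponent r ≠ 0
  · classical
    obtain ⟨hm, hms, hm0⟩ := Nat.find_spec hex
    have hmin : ∀ r < Nat.find hex, J.letter r ≠ s → K.exponent r = 0 := by
      intro r hr hrs
      by_contra h0
      exact Nat.find_min hex hr ⟨by omega, hrs, h0⟩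
    set m := Nat.find hex
    -- `m` is the first position where a letter other than `s = t` acts non-trivially. If no `s`
    -- precedes it, every word ending after an occurrence of `s` contains this factor, which kills
    -- `f_s v₁`.
    by_cases hocc : occ J s m = 0
    · intro k' r hr
      refine K.op_f_start_eq_zero hϖ hV hms hm0 hmin (by rw [hocc]; simp) ?_
      by_contra hle
      have h1 : r ≠ m := fun h => hms (h ▸ hr)
      exact Nat.count_iff_forall_not.mp hocc r (by omega) hr
    · exfalso
      -- Here `ℓ_1 = 0` and `a_1 = 1 - 2 = -1`, so `c_1 = -1`. The vanishing of `f_s v₁` holds for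
      -- exponents below `ℓ`, which is enough to produce an element of `T⁻`, and such an element
      -- forces `0 ≤ c_1`.
      have hl0 := K.eq_zero_of_op_ne_zero hϖ hV hlT.1 hm.le hmin
      obtain ⟨k', hk', _⟩ := K.exists_mem_Tminus hϖ hV hs (k := extendZero l)
        (by change IsWeightVector D _ _; rwa [K.vecOf_restrict])
        (fun k' hk' => K.op_f_start_eq_zero hϖ hV hms hm0 hmin
          (fun c hc => Nat.le_zero.mp ((hk' c).trans_eq (hl0 c hc))) hm)
      have hmq : m ≤ q := by omega
      have hoccq : occ J s m ≤ occ J s q := Nat.count_monotone _ hmq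
      obtain ⟨h1, h2⟩ := hbound _ hk' ⟨0, by omega⟩
      obtain ⟨a, ham, has, ha⟩ := exists_count_eq (fun p => J.letter p = s)
        (Nat.pos_of_ne_zero hocc)
      have h3 := K.psum_a s (by omega : a < q + 1) has
      rw [occ_succ has, show occ J s a = 0 from ha, Trail.aSum, if_pos rfl, D.diag, Finset.sum_eq_zero] at h3
      · have h4 := psum_eq_total (by omega : 1 ≤ occ J s (q + 1)) l
        have h5 := psum_eq_total (Nat.zero_le (occ J s (q + 1))) l
        simp only [coeffC, zero_add, Nat.sub_self] at h2 h3
        simp only [zero_add] at h1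
        omega
      · intro p hp
        rw [Finset.mem_filter, Finset.mem_range] at hp
        rw [hmin p (by omega) hp.2, Nat.cast_zero, zero_mul]
  · push Not at hex
    exfalso
    by_cases hocc : occ J s q = 0
    · have hempty : IsEmpty (Fin (occ J s (q + 1) - 1)) := by
        rw [hn, hocc]; exact Fin.isEmpty
      obtain ⟨k, hk, _⟩ : (fun i => isEmptyElim i) ∈ (fun k (i : Fin (occ J s (q + 1) - 1)) =>
          coord l k (i.val + 1)) '' K.Tminus s (q + 1) := by
        rw [hT]
        exact ⟨⟨fun i => isEmptyElim i, fun i => isEmptyElim i⟩, fun i => isEmptyElim i⟩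
      have hk' : IsWeightVector D (-(simpleReflection D s (J.w (q + 1) ϖ)))
          (K.op s (extendZero k) (q + 1) (K.vec 0)) := by
        rw [← K.vecOf_eq]; exact hk
      have hfix : ∀ {κ : ℕ → ℕ}, K.op s κ (q + 1) (K.vec 0) ≠ 0 →
          K.op s κ (q + 1) (K.vec 0) = K.vec 0 := fun h0 =>
        K.op_eq_self hex (K.eq_zero_of_op_ne_zero hϖ hV h0 le_rfl hex) _
      rw [hfix hk'.1] at hk'
      rw [hfix hlT.1] at hlT
      -- Both the `T⁺` and the `T⁻` ladder stay at the first vector, so `w ϖ = s_s ϖ` and `s_s w ϖ =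
      -- s_s ϖ`; together they give `ϖ = s_s ϖ`, that is, `α_s = 0`.
      have h1 := neg_injective (IsEigen.unique hlT.2 K.isEigen_start hlT.1)
      have h2 := neg_injective (IsEigen.unique hk'.2 K.isEigen_start hlT.1)
      rw [h1, ← Module.End.mul_apply, simpleReflection_mul_self, Module.End.one_apply,
        simpleReflection_fundamental hϖ, if_pos rfl, eq_comm, sub_eq_self] at h2
      exact D.root_indep.ne_zero s h2
    · obtain ⟨r, hr, hrs, hr0⟩ := K.exists_exponent_ne_zero hϖ hV hjJ hs hocc
      exact hr0 (hex r hr hrs)
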